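/- **Setting.** Let $n\ge 0$ and let $\mathcal V$ be a simply connected Hausdorff complex manifold spread over $\mathbb C^n$, i.e. equipped with a local homeomorphism $z=(z_1,\dots,z_n):\mathcal V\to\mathbb C^n$ giving its local coordinates (for instance a simply connected open subset of $\mathbb C^n$, or the universal covering of an open connected subset of $\mathbb C^n$). Let $\mathcal A=\mathcal H(\mathcal V)$ be the ring of holomorphic functions on $\mathcal V$, with the derivations $\partial_i=\partial/\partial z_i$, and let $df=\sum_i(\partial_if)\,dz_i$. The ring $\mathcal A$ is an integral domain, and $\partial_i$ and $d$ extend uniquely to $\mathrm{Frac}(\mathcal A)$. Let $\mathcal C\subset\mathcal A$ be a subring containing the constants $\mathbb C$ with $\partial_i\mathcal C\subset\mathcal C$ for all $i$; then $\mathrm{Frac}(\mathcal C)\subset\mathrm{Frac}(\mathcal A)$. Let $\mathcal T_n=\{t_{i,j}\}_{1\le i<j\le n}$ be an alphabet, totally ordered by $t_{i,j}\prec t_{k,l}$ iff $j>l$, or $j=l$ and $i>k$. Let $\mathcal T_n^*$ be the set of words over $\mathcal T_n$, with empty word $1_{\mathcal T_n^*}$, and let $\mathcal Lyn\,\mathcal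 T_n$ be the set of Lyndon words. Write $\langle S|w\rangle$ for the coefficient of the word $w$ in a noncommutative series $S\in\mathcal A\langle\langle\mathcal T_n\rangle\rangle$. The series $S$ is *grouplike* if $\langle S|1_{\mathcal T_n^*}\rangle=1$ and $\langle S|u\rangle\langle S|v\rangle=\langle S|u\sqcup\!\sqcup v\rangle$ for all words $u,v$, where $\sqcup\!\sqcup$ is the shuffle product and $\langle S|\cdot\rangle$ is extended linearly. A *Lie series* over $\mathbb C$ is a series in $\mathbb C\langle\langle\mathcal T_n\rangle\rangle$ all of whose homogeneous components are Lie polynomials; their set is $\mathcal Lie_{\mathbb C}\langle\langle\mathcal T_n\rangle\rangle$. For $1\le i<j\le n$ let $\omega_{i,j}=d\xi_{i,j}$ with $\xi_{i,j}\in\mathcal H(\mathcal V)$ and $\partial_k\xi_{i,j}\in\mathcal C$ for all $k$. Put $M_n=\sum_{1\le i<j\le n}\omega_{i,j}t_{i,j}$ and consider the equation $$\mathbf dS=M_nS,\qquad \mathbf dS:=\sum_{w\in\mathcal T_n^*}(d\langle S|w\rangle)\,w .\tag{$*$}$$ **Proposition.** Let $S\in\mathcal A\langle\langle\mathcal T_n\rangle\rangle$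 be a grouplike solution of $(*)$. 1. A series $H\in\mathcal A\langle\langle\mathcal T_n\rangle\rangle$ is a grouplike solution of $(*)$ if and only if there exists $C\in\mathcal Lie_{\mathbb C}\langle\langle\mathcal T_n\rangle\rangle$ such that $S=He^C$. 2. The following assertions are equivalent. - (a) The family $\{\langle S|w\rangle\}_{w\in\mathcal T_n^*}$ is $\mathcal C$-linearly free. - (b) The family $\{\langle S|l\rangle\}_{l\in\mathcal Lyn\,\mathcal T_n}$ is $\mathcal C$-algebraically free. - (c) The family $\{\langle S|t\rangle\}_{t\in\mathcal T_n}$ is $\mathcal C$-algebraically free. - (d) The family $\{\langle S|t\rangle\}_{t\in\mathcal T_n\cup\{1_{\mathcal T_n^*}\}}$ is $\mathcal C$-linearly free. - (e) For all complex numbers $(c_{i,j})_{1\le i<j\le n}$ and all $f\in\mathrm{Frac}(\mathcal C)$, if $\sum_{1\le i<j\le n}c_{i,j}\omega_{i,j}=df$, then $c_{i,j}=0$ for all $1\le i<j\le n$. - (f) The family $\{\omega_{i,j}\}_{1\le i<j\le n}$ is $\mathbb C$-linearly free and $d\,\mathrm{Frac}(\mathcal C)\cap\mathrm{span}_{\mathbb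 C}\{\omega_{i,j}\}_{1\le i<j\le n}=\{0\}$. -/

import Mathlib

open Filter Topology

namespace NCDiff

/-! ### The alphabet, words, shuffles and Lyndon words -/

/-- The alphabet `{t_{i,j}}` with `i < j` ranging over `n` indices. -/
abbrev Letter (n : ℕ) : Type := {q : Fin n × Fin n // q.1 < q.2}

/-- The total order on letters for which `t_{i,j} < t_{k,l}` iff `j > l`, or `j = l` and `i > k`. -/
def Letter.lt {n : ℕ} (a b : Letter n) : Prop :=
  b.1.2 < a.1.2 ∨ (a.1.2 = b.1.2 ∧ b.1.1 < a.1.1)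

/-- A Lyndon word (for the order `r` on letters): a nonempty word which is strictly smaller, in the
lexicographic order, than each of its nonempty proper right factors. -/
def IsLyndon {X : Type*} (r : X → X → Prop) (l : List X) : Prop :=
  l ≠ [] ∧ ∀ u v : List X, u ≠ [] → v ≠ [] → l = u ++ v → List.Lex r l v

/-- The shuffle product of two words, as the list (with multiplicities) of the words in it. -/
def shuffle {X : Type*} : List X → List X → List (List X)
  | [], v => [v]
  | x :: u, [] => [x :: u]
  | x :: u, y :: v =>
      (shuffle u (y :: v)).map (fun w => x :: w) ++ (shuffle (x :: u) v).map (fun w => y :: w)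
termination_by u v => u.length + v.length

/-! ### Noncommutative formal series -/

/-- Formal series in noncommuting variables `X` with coefficients in `R`; `S w` is the
coefficient of the word `w`. -/
abbrev NCSeries (R X : Type*) : Type _ := List X → R

namespace NCSeries

variable {R X : Type*}

/-- Concatenation product of a series `M` with coefficients in an `R`-module `N` by a series `S`
with coefficients in the commutative ring `R`: the coefficient of `w` is the sum of
`⟨M|u⟩ ⟨S|v⟩` over all factorizations `w = u v`. For `N = R` it is the usual product. -/
def conc [CommRing R] {N : Type*} [AddCommGroup N] [Module R N]
    (M : NCSeries N X) (S : NCSeries R X) : NCSeries N X :=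
  fun w => ∑ k ∈ Finset.range (w.length + 1), S (w.drop k) • M (w.take k)

/-- The series `1`. -/
def one [CommRing R] : NCSeries R X
  | [] => 1
  | _ :: _ => 0

/-- Powers for the concatenation product. -/
def pow [CommRing R] (S : NCSeries R X) : ℕ → NCSeries R X
  | 0 => one
  | k + 1 => conc S (pow S k)

/-- The exponential `∑ C ^ k / k!` of a series `C` without constant term
(`C ^ k` has no coefficients at words of length less than `k`, so the sum is finite at each word). -/
noncomputable def exp [CommRing R] [Algebra ℂ R] (C : NCSeries R X) : NCSeries R X :=
  fun w => ∑ k ∈ Finset.range (w.length + 1), ((k.factorial : ℂ)⁻¹) • pow C k w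

/-- A series over `ℂ` seen as a series with constant coefficients in a `ℂ`-algebra. -/
def ofConst (A : Type*) [CommRing A] [Algebra ℂ A] (C : NCSeries ℂ X) : NCSeries A X :=
  fun w => algebraMap ℂ A (C w)

/-- Grouplike series for the coproduct dual to the shuffle: characters of the shuffle algebra. -/
def IsGrouplike [CommRing R] (S : NCSeries R X) : Prop :=
  S [] = 1 ∧ ∀ u v : List X, ((shuffle u v).map S).sum = S u * S v

attribute [local instance 100] LieRing.ofAssociativeRing

/-- Lie series: every homogeneous component is a Lie polynomial, i.e. belongs to the Lie subalgebra
generated by the letters in the algebra of noncommutative polynomials. -/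
def IsLieSeries [CommRing R] (C : NCSeries R X) : Prop :=
  ∀ k : ℕ, ∃ P ∈ LieSubalgebra.lieSpan R (MonoidAlgebra R (FreeMonoid X))
      (Set.range fun x : X => MonoidAlgebra.of R (FreeMonoid X) (FreeMonoid.of x)),
    ∀ w : FreeMonoid X, P.coeff w = if w.toList.length = k then C w.toList else 0

end NCSeries

/-! ### Holomorphic functions on a manifold spread over `ℂ^n` -/

section Holomorphic

variable {n : ℕ} {V : Type*} [TopologicalSpace V]

/-- `f` is holomorphic for the coordinates `p : V → ℂ^n` (a local homeomorphism): near each point,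
`f` is an analytic function of the coordinates. -/
def IsHolo (p : V → Fin n → ℂ) (f : V → ℂ) : Prop :=
  ∀ v, ∃ g : (Fin n → ℂ) → ℂ, AnalyticAt ℂ g (p v) ∧ f =ᶠ[𝓝 v] g ∘ p

/-- The ring of holomorphic functions on `V`. -/
def Holo (p : V → Fin n → ℂ) : Subalgebra ℂ (V → ℂ) where
  carrier := {f | IsHolo p f}
  mul_mem' := by
    intro a b ha hb v
    obtain ⟨g, hg, hag⟩ := ha v
    obtain ⟨h, hh, hbh⟩ := hb v
    exact ⟨g * h, hg.mul hh, hag.mul hbh⟩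
  add_mem' := by
    intro a b ha hb v
    obtain ⟨g, hg, hag⟩ := ha v
    obtain ⟨h, hh, hbh⟩ := hb v
    exact ⟨g + h, hg.add hh, hag.add hbh⟩
  algebraMap_mem' := fun c _ => ⟨fun _ => c, analyticAt_const, EventuallyEq.rfl⟩

/-- The partial derivative `∂f/∂z_i` at `v`, computed on an analytic expression of `f` in terms of
the coordinates near `v`. -/
noncomputable def pdFun {p : V → Fin n → ℂ} (i : Fin n) (f : Holo p) (v : V) : ℂ :=
  fderiv ℂ (f.2 v).choose (p v) (Pi.single i 1)

theorem pdFun_eq {p : V → Fin n → ℂ} (hp : IsLocalHomeomorph p) (i : Fin n) (f : Holo p) (v : V)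
    (g : (Fin n → ℂ) → ℂ) (hg : (f : V → ℂ) =ᶠ[𝓝 v] g ∘ p) :
    pdFun i f v = fderiv ℂ g (p v) (Pi.single i 1) := by
  have h := (f.2 v).choose_spec.2.symm.trans hg
  have h2 : (f.2 v).choose =ᶠ[𝓝 (p v)] g := by
    rw [← hp.map_nhds_eq v]
    exact h
  unfold pdFun
  rw [h2.fderiv_eq]

theorem pdFun_holo {p : V → Fin n → ℂ} (hp : IsLocalHomeomorph p) (i : Fin n) (f : Holo p) :
    IsHolo p (pdFun i f) := by
  intro v
  obtain ⟨g, hg, hfg⟩ := f.2 v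
  refine ⟨fun x => fderiv ℂ g x (Pi.single i 1), ?_, ?_⟩
  · exact (ContinuousLinearMap.apply ℂ ℂ (Pi.single i (1 : ℂ) : Fin n → ℂ)).analyticAt _
      |>.comp hg.fderiv
  · filter_upwards [hfg.eventuallyEq_nhds] with w hw
    exact pdFun_eq hp i f w g hw

/-- The derivation `∂_i = ∂/∂z_i` of the ring of holomorphic functions. -/
noncomputable def pd {p : V → Fin n → ℂ} (hp : IsLocalHomeomorph p) (i : Fin n) :
    Derivation ℂ (Holo p) (Holo p) :=
  Derivation.mk'
    { toFun := fun f => ⟨pdFun i f, pdFun_holo hp i f⟩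
      map_add' := by
        intro a b
        ext v
        obtain ⟨g, hg, hag⟩ := a.2 v
        obtain ⟨h, hh, hbh⟩ := b.2 v
        change pdFun i (a + b) v = pdFun i a v + pdFun i b v
        rw [pdFun_eq hp i a v g hag, pdFun_eq hp i b v h hbh,
          pdFun_eq hp i (a + b) v (g + h) (hag.add hbh),
          fderiv_add hg.differentiableAt hh.differentiableAt]
        rfl
      map_smul' := by
        intro c a
        ext v
        obtain ⟨g, hg, hag⟩ := a.2 v
        change pdFun i (c • a) v = c • pdFun i a v
        rw [pdFun_eq hp i a v g hag, pdFun_eq hp i (c • a) v (c • g) (hag.const_smul c),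
          fderiv_const_smul hg.differentiableAt]
        rfl }
    (by
      intro a b
      ext v
      obtain ⟨g, hg, hag⟩ := a.2 v
      obtain ⟨h, hh, hbh⟩ := b.2 v
      change pdFun i (a * b) v = (a : V → ℂ) v * pdFun i b v + (b : V → ℂ) v * pdFun i a v
      rw [pdFun_eq hp i a v g hag, pdFun_eq hp i b v h hbh,
        pdFun_eq hp i (a * b) v (g * h) (hag.mul hbh),
        fderiv_mul hg.differentiableAt hh.differentiableAt, hag.eq_of_nhds, hbh.eq_of_nhds]
      rfl)

/-- The total differential `df = ∑ (∂_k f) dz_k`. As `p` is a local homeomorphism, the forms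
`dz_1, …, dz_n` are a basis of the module of holomorphic 1-forms on `V`; a 1-form is given by its
coefficients in it. -/
noncomputable def totalD {p : V → Fin n → ℂ} (hp : IsLocalHomeomorph p) (f : Holo p) :
    Fin n → Holo p :=
  fun k => pd hp k f

/-- The series `M_n = ∑ ω_{i,j} t_{i,j}` with coefficients in the 1-forms. -/
def connection {p : V → Fin n → ℂ} (ω : Letter n → Fin n → Holo p) :
    NCSeries (Fin n → Holo p) (Letter n)
  | [t] => ω t
  | _ => 0

/-- `S` is a solution of `dS = M_n S`, where `d` acts on series coefficientwise. -/
def IsSolution {p : V → Fin n → ℂ} (hp : IsLocalHomeomorph p) (ω : Letter n → Fin n → Holo p)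
    (S : NCSeries (Holo p) (Letter n)) : Prop :=
  (fun w => totalD hp (S w)) = NCSeries.conc (connection ω) S

end Holomorphic

/-! ### Differentials of fractions -/

section Fractions

variable {A : Type*} [CommRing A] [Algebra ℂ A]

/-- The ring morphism `a ↦ a + ε D(a)` to the dual numbers over the ring of fractions. -/
noncomputable def dualHom (D : Derivation ℂ A A) : A →+* DualNumber (FractionRing A) where
  toFun a := TrivSqZeroExt.inl (algebraMap A _ a) + TrivSqZeroExt.inr (algebraMap A _ (D a))
  map_one' := by ext <;> simp
  map_zero' := by ext <;> simp
  map_add' := by intro a b; ext <;> simp [Algebra.smul_def]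
  map_mul' := by
    intro a b
    ext
    · simp
    · simp only [TrivSqZeroExt.snd_add, TrivSqZeroExt.snd_inl, TrivSqZeroExt.snd_inr,
        TrivSqZeroExt.snd_mul, TrivSqZeroExt.fst_add, TrivSqZeroExt.fst_inl,
        TrivSqZeroExt.fst_inr, Derivation.leibniz, smul_eq_mul, map_add, map_mul,
        MulOpposite.smul_eq_mul_unop, MulOpposite.unop_op, zero_add, add_zero]
      ring

theorem dualHom_isUnit (D : Derivation ℂ A A) (y : nonZeroDivisors A) :
    IsUnit (dualHom D (y : A)) := by
  rw [TrivSqZeroExt.isUnit_iff_isUnit_fst]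
  simpa [dualHom] using IsLocalization.map_units (FractionRing A) y

/-- The extension of `dualHom` to fractions. -/
noncomputable def fracDualHom (D : Derivation ℂ A A) :
    FractionRing A →+* DualNumber (FractionRing A) :=
  IsLocalization.lift (M := nonZeroDivisors A) (dualHom_isUnit D)

theorem fst_fracDualHom (D : Derivation ℂ A A) (f : FractionRing A) :
    (fracDualHom D f).fst = f := by
  have h : ((TrivSqZeroExt.fstHom (FractionRing A) (FractionRing A) (FractionRing A)).toRingHom.comp
      (fracDualHom D)) = RingHom.id _ := by
    apply IsLocalization.ringHom_ext (nonZeroDivisors A)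
    ext a
    simp [fracDualHom, dualHom]
  exact congrArg (fun φ => φ f) h

/-- The unique extension of a derivation `D` of `A` to the ring of fractions of `A`. -/
noncomputable def fracDer (D : Derivation ℂ A A) (f : FractionRing A) : FractionRing A :=
  (fracDualHom D f).snd

theorem fracDer_algebraMap (D : Derivation ℂ A A) (a : A) :
    fracDer D (algebraMap A _ a) = algebraMap A _ (D a) := by
  simp [fracDer, fracDualHom, dualHom, ← Algebra.algebraMap_eq_smul_one]

theorem fracDer_add (D : Derivation ℂ A A) (f g : FractionRing A) :
    fracDer D (f + g) = fracDer D f + fracDer D g := by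
  simp [fracDer]

theorem fracDer_mul (D : Derivation ℂ A A) (f g : FractionRing A) :
    fracDer D (f * g) = f * fracDer D g + g * fracDer D f := by
  simp [fracDer, fst_fracDualHom, mul_comm]

/-- The fraction field of a subring `C` of `A`, inside the fractions of `A`. -/
def fracOf (C : Subalgebra ℂ A) : Set (FractionRing A) :=
  {f | ∃ a ∈ C, ∃ b ∈ C, b ≠ 0 ∧ f * algebraMap A _ b = algebraMap A _ a}

end Fractions

section FractionForms

variable {n : ℕ} {V : Type*} [TopologicalSpace V]

/-- The total differential of a fraction of holomorphic functions, by its coefficients in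
`dz_1, …, dz_n`. -/
noncomputable def fracD {p : V → Fin n → ℂ} (hp : IsLocalHomeomorph p)
    (f : FractionRing (Holo p)) : Fin n → FractionRing (Holo p) :=
  fun k => fracDer (pd hp k) f

/-- A holomorphic 1-form seen as a 1-form with coefficients in the fractions. -/
noncomputable def toFracForm {p : V → Fin n → ℂ} (η : Fin n → Holo p) :
    Fin n → FractionRing (Holo p) :=
  fun k => algebraMap (Holo p) _ (η k)

end FractionForms

end NCDiff

/-!
The argument rests on three facts about words and series, and one about differential fields.

**Products and logarithms of grouplike series.** The coproduct dual to the shuffle is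
multiplicative for concatenation (`coprod_conc`). Hence the powers `G ^ m` of a grouplike series `G`
are grouplike; the coefficient of a word in `G ^ m` is a polynomial in `m` (`powPoly`), so that
identities between natural powers hold for all exponents. The exponent `-1` gives a grouplike
inverse. The derivative at `m = 0` gives the logarithm, which is primitive, i.e. vanishes on the
shuffles of nonempty words, and the differential equation satisfied by `G ^ m` gives
`exp (log G) = G`.

**Primitive series are the Lie series.** Brackets of primitive series are primitive. Conversely,
expanding the iterated brackets `[⋯[[x₁, x₂], x₃], ⋯, x_k]` of the words of a primitive series gives
the Dynkin–Specht–Wever identity `IsPrimitive.sum_bracketSum`, which writes `k` times the component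
of degree `k` as a combination of iterated brackets.

If `H` and `S` are grouplike solutions, then `H⁻¹ S` has zero derivative, so it is a constant
grouplike series, i.e. the exponential of a constant Lie series. This is the first assertion; its
converse reverses the computation.

**Lyndon words.** The largest word in the shuffle product of Lyndon words is their nonincreasing
concatenation (`le_revFlatten_of_mem_shuffleList`), and a word has at most one factorization into
nonincreasing Lyndon words. So the shuffle monomials in Lyndon words are linearly independent, and
linear independence of the `⟨S | w⟩` implies algebraic independence of the `⟨S | l⟩`, `l` Lyndon.

**Linear independence.** A solution has `d⟨S | t w⟩ = ω_t ⟨S | w⟩`. Differentiating a linear relation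
of least degree over `Frac 𝒞`, with the least number of terms of that degree, shows that its
coefficients of highest degree are constants and that some nontrivial constant combination of the
`ω_t` is the differential of an element of `Frac 𝒞` (`eq_zero_of_sum_wordSum_mul_eq_zero`). This uses
that elements of `Frac 𝒜` with zero differential are constants, which follows from the identity
theorem on the connected manifold. The other implications between the six conditions are short.
-/

namespace NCDiff

/-! ### Shuffles of words and the lexicographic order -/

section Shuffle

variable {X : Type*}

@[simp] theorem shuffle_nil_left (v : List X) : shuffle [] v = [v] := by
  simp [shuffle]

@[simp] theorem shuffle_nil_right (u : List X) : shuffle u [] = [u] := by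
  cases u <;> simp [shuffle]

theorem shuffle_cons_cons (x y : X) (u v : List X) :
    shuffle (x :: u) (y :: v) =
      (shuffle u (y :: v)).map (fun w => x :: w) ++ (shuffle (x :: u) v).map (fun w => y :: w) := by
  rw [shuffle]

theorem mem_shuffle_cons_cons {x y : X} {u v w : List X} :
    w ∈ shuffle (x :: u) (y :: v) ↔
      (∃ w' ∈ shuffle u (y :: v), x :: w' = w) ∨ ∃ w' ∈ shuffle (x :: u) v, y :: w' = w := by
  simp [shuffle_cons_cons]

theorem cons_mem_shuffle_left {u v w : List X} (x : X) (h : w ∈ shuffle u v) :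
    x :: w ∈ shuffle (x :: u) v := by
  cases v with
  | nil => simpa using h
  | cons y v => exact mem_shuffle_cons_cons.2 (Or.inl ⟨w, h, rfl⟩)

theorem cons_mem_shuffle_right {u v w : List X} (y : X) (h : w ∈ shuffle u v) :
    y :: w ∈ shuffle u (y :: v) := by
  cases u with
  | nil => simpa using h
  | cons x u => exact mem_shuffle_cons_cons.2 (Or.inr ⟨w, h, rfl⟩)

theorem append_mem_shuffle (u v : List X) : u ++ v ∈ shuffle u v := by
  induction u with
  | nil => simp
  | cons x u ih => exact cons_mem_shuffle_left x ih

theorem append_mem_shuffle_swap (u v : List X) : v ++ u ∈ shuffle u v := by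
  induction v with
  | nil => simp
  | cons y v ih => exact cons_mem_shuffle_right y ih

theorem length_of_mem_shuffle {u v w : List X} (h : w ∈ shuffle u v) :
    w.length = u.length + v.length := by
  induction w generalizing u v with
  | nil =>
    cases u <;> cases v <;> simp_all [shuffle_cons_cons]
  | cons z w ih =>
    cases u with
    | nil => simp_all
    | cons x u =>
      cases v with
      | nil => simp_all
      | cons y v =>
        rcases mem_shuffle_cons_cons.1 h with ⟨w', h', e⟩ | ⟨w', h', e⟩
        · obtain ⟨rfl, rfl⟩ := List.cons.inj e
          have := ih h'
          simp only [List.length_cons] at this ⊢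
          omega
        · obtain ⟨rfl, rfl⟩ := List.cons.inj e
          have := ih h'
          simp only [List.length_cons] at this ⊢
          omega

end Shuffle

section LexOrder

variable {X : Type*} [LinearOrder X]

theorem cons_le_cons_iff' {a b : X} {u v : List X} :
    a :: u ≤ b :: v ↔ a < b ∨ a = b ∧ u ≤ v := by
  rw [← not_lt, List.cons_lt_cons_iff, ← not_lt (a := v)]
  rcases lt_trichotomy a b with h | h | h
  · simp [h, h.not_gt, h.ne']
  · simp [h]
  · simp [h, h.not_gt, h.ne']

theorem nil_le' (u : List X) : [] ≤ u := by
  rw [← not_lt]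
  exact List.not_lt_nil u

theorem le_append (u v : List X) : u ≤ u ++ v := by
  induction u with
  | nil => exact nil_le' _
  | cons a u ih => exact cons_le_cons_iff'.2 (Or.inr ⟨rfl, ih⟩)

/-- If `y ≤ x`, a prefix `p` may be moved from `x` to `y` without decreasing the largest word of
the shuffle: exchange the roles of the two words until they have consumed equal amounts of `x`
and `y`, or until the first difference between `x` and `y` decides. -/
theorem exists_le_mem_shuffle_move {u : List X} :
    ∀ {p x y : List X}, u ∈ shuffle (p ++ x) y → y ≤ x → ∃ u' ∈ shuffle x (p ++ y), u ≤ u' := by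
  induction u with
  | nil =>
    intro p x y _ _
    exact ⟨_, append_mem_shuffle _ _, nil_le' _⟩
  | cons c u ih =>
    intro p x y hu hyx
    cases p with
    | nil => exact ⟨_, hu, le_rfl⟩
    | cons d p =>
      cases y with
      | nil =>
        rw [shuffle_nil_right, List.mem_singleton] at hu
        refine ⟨_, append_mem_shuffle_swap _ _, ?_⟩
        simp [hu]
      | cons b y =>
        rw [List.cons_append, mem_shuffle_cons_cons] at hu
        rcases hu with ⟨w, hw, e⟩ | ⟨w, hw, e⟩
        · obtain ⟨rfl, rfl⟩ := List.cons.inj e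
          obtain ⟨u', hu', hle⟩ := ih hw hyx
          exact ⟨_, cons_mem_shuffle_right d hu', cons_le_cons_iff'.2 (Or.inr ⟨rfl, hle⟩)⟩
        · obtain ⟨rfl, rfl⟩ := List.cons.inj e
          cases x with
          | nil => exact absurd hyx (not_le.2 (List.nil_lt_cons _ _))
          | cons a x =>
            rcases cons_le_cons_iff'.1 hyx with h | ⟨rfl, h⟩
            · exact ⟨_, append_mem_shuffle _ _, cons_le_cons_iff'.2 (Or.inl h)⟩
            · have hw' : w ∈ shuffle ((d :: p ++ [b]) ++ x) y := by simpa using hw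
              obtain ⟨u', hu', hle⟩ := ih hw' h
              refine ⟨b :: u', cons_mem_shuffle_left b ?_, cons_le_cons_iff'.2 (Or.inr ⟨rfl, hle⟩)⟩
              simpa using hu'

/-- Replacing a factor of a shuffle by a larger word of the same length makes larger words. -/
theorem exists_le_mem_shuffle_of_le {u : List X} :
    ∀ {v w y : List X}, v.length = w.length → v ≤ w → u ∈ shuffle v y →
      ∃ u' ∈ shuffle w y, u ≤ u' := by
  induction u with
  | nil =>
    intro v w y _ _ _
    exact ⟨_, append_mem_shuffle _ _, nil_le' _⟩
  | cons c u ih =>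
    intro v w y hl hvw hu
    cases v with
    | nil =>
      obtain rfl : w = [] := by simpa using hl.symm
      exact ⟨_, hu, le_rfl⟩
    | cons a v =>
      cases w with
      | nil => simp at hl
      | cons b w =>
        cases y with
        | nil =>
          rw [shuffle_nil_right, List.mem_singleton] at hu
          exact ⟨b :: w, by simp, hu ▸ hvw⟩
        | cons d y =>
          rcases mem_shuffle_cons_cons.1 hu with ⟨t, ht, e⟩ | ⟨t, ht, e⟩
          · obtain ⟨rfl, rfl⟩ := List.cons.inj e
            rcases cons_le_cons_iff'.1 hvw with h | ⟨rfl, h⟩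
            · exact ⟨_, append_mem_shuffle _ _, cons_le_cons_iff'.2 (Or.inl h)⟩
            · obtain ⟨u', hu', hle⟩ := ih (by simpa using hl) h ht
              exact ⟨_, cons_mem_shuffle_left _ hu', cons_le_cons_iff'.2 (Or.inr ⟨rfl, hle⟩)⟩
          · obtain ⟨rfl, rfl⟩ := List.cons.inj e
            obtain ⟨u', hu', hle⟩ := ih hl hvw ht
            exact ⟨_, cons_mem_shuffle_right _ hu', cons_le_cons_iff'.2 (Or.inr ⟨rfl, hle⟩)⟩

/-- If `y` is at most every nonempty right factor of `x`, then `x ++ y` is the largest word of the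
shuffle of `x` and `y`: always taking the next letter from `x` is optimal. -/
theorem le_append_of_mem_shuffle {x y : List X}
    (h : ∀ s, s ≠ [] → s <:+ x → y ≤ s) {u : List X} (hu : u ∈ shuffle x y) : u ≤ x ++ y := by
  induction x generalizing u with
  | nil => simp_all
  | cons a x ih =>
    have hx : ∀ u' ∈ shuffle x y, a :: u' ≤ (a :: x) ++ y := fun u' hu' =>
      cons_le_cons_iff'.2 (Or.inr ⟨rfl, ih (fun s hs hsx =>
        h s hs (hsx.trans (List.suffix_cons a x))) hu'⟩)
    have hy : y ≤ a :: x := h _ (by simp) List.suffix_rfl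
    cases y with
    | nil => simp_all
    | cons b y =>
      rcases mem_shuffle_cons_cons.1 hu with ⟨w, hw, rfl⟩ | ⟨w, hw, rfl⟩
      · exact hx w hw
      · rcases cons_le_cons_iff'.1 hy with hba | ⟨rfl, hyx⟩
        · exact cons_le_cons_iff'.2 (Or.inl hba)
        · obtain ⟨u', hu', hle⟩ := exists_le_mem_shuffle_move (p := [b]) (x := x) (y := y)
            (by simpa using hw) hyx
          exact (cons_le_cons_iff'.2 (Or.inr ⟨rfl, hle⟩)).trans (hx u' hu')

end LexOrder

/-! ### Lyndon factorizations -/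

section Lyndon

variable {X : Type*}

/-- The concatenation `l_k ⋯ l_1` of a list `[l_1, …, l_k]` of words. -/
def revFlatten : List (List X) → List X
  | [] => []
  | l :: ls => revFlatten ls ++ l

/-- The shuffle product of a list of words, as the list of the words in it. -/
def shuffleList : List (List X) → List (List X)
  | [] => [[]]
  | l :: ls => (shuffleList ls).flatMap fun w => shuffle w l

theorem revFlatten_mem_shuffleList (ls : List (List X)) : revFlatten ls ∈ shuffleList ls := by
  induction ls with
  | nil => simp [revFlatten, shuffleList]
  | cons l ls ih => exact List.mem_flatMap.2 ⟨_, ih, append_mem_shuffle _ _⟩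

theorem length_of_mem_shuffleList {ls : List (List X)} {u : List X} (hu : u ∈ shuffleList ls) :
    u.length = (revFlatten ls).length := by
  induction ls generalizing u with
  | nil => simp_all [revFlatten, shuffleList]
  | cons l ls ih =>
    obtain ⟨w, hw, hu⟩ := List.mem_flatMap.1 hu
    rw [length_of_mem_shuffle hu, ih hw, revFlatten, List.length_append]

variable [LinearOrder X]

theorem IsLyndon.le_suffix {l s : List X} (hl : IsLyndon (· < ·) l) (hs : s ≠ []) (h : s <:+ l) :
    l ≤ s := by
  obtain ⟨t, rfl⟩ := h
  cases t with
  | nil => exact le_rfl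
  | cons a t => exact le_of_lt (hl.2 (a :: t) s (by simp) hs rfl)

/-- A lower bound of a list of Lyndon words is a lower bound of the nonempty right factors of their
concatenation, since such a factor begins with a right factor of one of the words. -/
theorem le_suffix_revFlatten {l s : List X} {ls : List (List X)}
    (hL : ∀ m ∈ ls, IsLyndon (· < ·) m) (hle : ∀ m ∈ ls, l ≤ m) (hs : s ≠ [])
    (h : s <:+ revFlatten ls) : l ≤ s := by
  induction ls generalizing s with
  | nil =>
    simp only [revFlatten, List.suffix_nil] at h
    exact absurd h hs
  | cons m ls ih =>
    obtain ⟨r, hr⟩ := h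
    rw [revFlatten] at hr
    rcases List.append_eq_append_iff.1 hr with ⟨t, ht, rfl⟩ | ⟨t, -, ht⟩
    · by_cases h0 : t = []
      · simpa [h0] using hle m (by simp)
      · exact (ih (fun m hm => hL m (by simp [hm])) (fun m hm => hle m (by simp [hm])) h0
          ⟨r, ht.symm⟩).trans (le_append _ _)
    · exact (hle m (by simp)).trans ((hL m (by simp)).le_suffix hs ⟨t, ht.symm⟩)

/-- In the shuffle product of Lyndon words the largest word is their nonincreasing
concatenation. -/
theorem le_revFlatten_of_mem_shuffleList {ls : List (List X)}
    (hL : ∀ m ∈ ls, IsLyndon (· < ·) m) (hs : ls.Pairwise (· ≤ ·)) {u : List X}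
    (hu : u ∈ shuffleList ls) : u ≤ revFlatten ls := by
  induction ls generalizing u with
  | nil => simp_all [revFlatten, shuffleList]
  | cons l ls ih =>
    obtain ⟨w, hw, hu⟩ := List.mem_flatMap.1 hu
    obtain ⟨hl, hs⟩ := List.pairwise_cons.1 hs
    have hL' : ∀ m ∈ ls, IsLyndon (· < ·) m := fun m hm => hL m (by simp [hm])
    obtain ⟨u', hu', hle⟩ := exists_le_mem_shuffle_of_le (length_of_mem_shuffleList hw)
      (ih hL' hs hw) hu
    exact hle.trans (le_append_of_mem_shuffle
      (fun s hs hsx => le_suffix_revFlatten hL' hl hs hsx) hu')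

/-- Uniqueness of the factorization into nonincreasing Lyndon words: the last factor is the smallest
nonempty right factor. -/
theorem revFlatten_injOn {ls ms : List (List X)}
    (hls : ∀ m ∈ ls, IsLyndon (· < ·) m) (hms : ∀ m ∈ ms, IsLyndon (· < ·) m)
    (sls : ls.Pairwise (· ≤ ·)) (sms : ms.Pairwise (· ≤ ·))
    (h : revFlatten ls = revFlatten ms) : ls = ms := by
  induction ls generalizing ms with
  | nil =>
    cases ms with
    | nil => rfl
    | cons m ms =>
      have := (hms m (by simp)).1
      simp [revFlatten] at h
      exact absurd h.2 this
  | cons l ls ih =>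
    cases ms with
    | nil =>
      have := (hls l (by simp)).1
      simp [revFlatten] at h
      exact absurd h.2 this
    | cons m ms =>
      have key : ∀ {a b : List X} {as bs : List (List X)}, (∀ m ∈ a :: as, IsLyndon (· < ·) m) →
          b ≠ [] → (a :: as).Pairwise (· ≤ ·) → revFlatten (a :: as) = revFlatten (b :: bs) →
          a ≤ b := by
        intro a b as bs hL hb hs e
        refine le_suffix_revFlatten hL ?_ hb (e ▸ ⟨revFlatten bs, rfl⟩)
        intro c hc
        rcases List.mem_cons.1 hc with rfl | hc
        · exact le_rfl
        · exact List.rel_of_pairwise_cons hs hc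
      obtain rfl : l = m := le_antisymm (key hls (hms m (by simp)).1 sls h)
        (key hms (hls l (by simp)).1 sms h.symm)
      rw [ih (fun m hm => hls m (by simp [hm])) (fun m hm => hms m (by simp [hm]))
        (List.pairwise_cons.1 sls).2 (List.pairwise_cons.1 sms).2 (List.append_cancel_right h)]

end Lyndon

section AlgebraicIndependence

variable {X : Type*} {R A : Type*} [CommRing R] [CommRing A] [Algebra R A]

/-- A grouplike series is a character also on the shuffle product of several words. -/
theorem NCSeries.IsGrouplike.sum_shuffleList {S : NCSeries A X} (hS : S.IsGrouplike)
    (ls : List (List X)) : ((shuffleList ls).map S).sum = (ls.map S).prod := by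
  induction ls with
  | nil => simp [shuffleList, hS.1]
  | cons l ls ih =>
    have key : ∀ L : List (List X), ((L.flatMap fun w => shuffle w l).map S).sum =
        S l * (L.map S).sum := by
      intro L
      induction L with
      | nil => simp
      | cons w L ih => simp [ih, hS.2, mul_add, mul_comm]
    rw [shuffleList, key, ih, List.map_cons, List.prod_cons]

/-- The multiplicity of a word in a list, as a coefficient. -/
theorem sum_map_single_apply [DecidableEq X] (L : List (List X)) (w : List X) :
    (L.map fun u => Finsupp.single u (1 : R)).sum w = (L.count w : R) := by
  induction L with
  | nil => simp
  | cons u L ih =>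
    rw [List.map_cons, List.sum_cons, Finsupp.add_apply, ih, List.count_cons,
      Finsupp.single_apply]
    by_cases h : u = w <;> simp [h, add_comm]

/-- If the coefficients of a character of the shuffle algebra are linearly independent, its
coefficients at the Lyndon words are algebraically independent: a shuffle monomial in Lyndon words
has as its largest word the nonincreasing concatenation of its factors, from which the monomial is
recovered. -/
theorem algebraicIndependent_lyndon [LinearOrder X] [IsDomain R] [CharZero R] {S : NCSeries A X}
    (hS : S.IsGrouplike) (hli : LinearIndependent R (fun w : List X => S w)) :
    AlgebraicIndependent R (fun l : {l : List X // IsLyndon (· < ·) l} => S l.1) := by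
  classical
  -- `fac m` lists the factors of the monomial `m` in nondecreasing order; `revFlatten` concatenates
  -- them in nonincreasing order.
  let fac : ({l : List X // IsLyndon (· < ·) l} →₀ ℕ) → List (List X) := fun m =>
    (m.toMultiset.map Subtype.val).sort (· ≤ ·)
  have fac_coe (m) : ((fac m : List (List X)) : Multiset (List X)) =
      m.toMultiset.map Subtype.val := Multiset.sort_eq _ _
  have fac_lyn (m) : ∀ l ∈ fac m, IsLyndon (· < ·) l := by
    intro l hl
    rw [← Multiset.mem_coe, fac_coe, Multiset.mem_map] at hl
    obtain ⟨a, -, rfl⟩ := hl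
    exact a.2
  have fac_sorted (m) : (fac m).Pairwise (· ≤ ·) := Multiset.pairwise_sort _ _
  have word_inj : Function.Injective fun m => revFlatten (fac m) := by
    intro m m' h
    have e := revFlatten_injOn (fac_lyn m) (fac_lyn m') (fac_sorted m) (fac_sorted m') h
    have e2 : m.toMultiset.map Subtype.val = m'.toMultiset.map Subtype.val := by
      rw [← fac_coe, ← fac_coe, e]
    simpa using congrArg Multiset.toFinsupp (Multiset.map_injective Subtype.val_injective e2)
  -- `Φ m` is the shuffle product of the factors of `m`, as a combination of words.
  let Φ : ({l : List X // IsLyndon (· < ·) l} →₀ ℕ) → (List X →₀ R) := fun m =>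
    ((shuffleList (fac m)).map fun u => Finsupp.single u (1 : R)).sum
  have hΦ (m) : Finsupp.linearCombination R (fun w : List X => S w) (Φ m) =
      m.prod fun l k => S l.1 ^ k := by
    have h1 : Finsupp.linearCombination R (fun w : List X => S w) (Φ m) =
        ((shuffleList (fac m)).map S).sum := by
      simp only [Φ]
      rw [map_list_sum, List.map_map]
      congr 2
      funext u
      simp
    rw [h1, hS.sum_shuffleList]
    have h2 : ((fac m).map S).prod = ((m.toMultiset.map Subtype.val).map S).prod := by
      rw [← fac_coe, Multiset.map_coe, Multiset.prod_coe]
    rw [h2, Multiset.map_map, Finsupp.toMultiset_map, Finsupp.prod_toMultiset,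
      Finsupp.prod_mapDomain_index (fun _ => pow_zero _) (fun _ _ _ => pow_add _ _ _)]
    rfl
  rw [algebraicIndependent_iff]
  intro P hP
  by_contra hne
  have hsum : ∑ m ∈ P.support, P.coeff m • Φ m = 0 := by
    apply hli
    rw [map_zero, map_sum, ← hP, MvPolynomial.aeval_def, MvPolynomial.eval₂_eq]
    refine Finset.sum_congr rfl fun m _ => ?_
    rw [map_smul, hΦ, Algebra.smul_def]
    rfl
  -- The largest of the leading words occurs in a single shuffle product.
  obtain ⟨m₀, hm₀, hmax⟩ := Finset.exists_max_image P.support (fun m => revFlatten (fac m))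
    (MvPolynomial.support_nonempty.2 hne)
  have h := DFunLike.congr_fun hsum (revFlatten (fac m₀))
  rw [Finsupp.finsetSum_apply, Finset.sum_eq_single m₀] at h
  · rw [Finsupp.smul_apply, sum_map_single_apply, smul_eq_mul, Finsupp.zero_apply, mul_eq_zero] at h
    rcases h with h | h
    · exact MvPolynomial.mem_support_iff.1 hm₀ h
    · rw [Nat.cast_eq_zero, List.count_eq_zero] at h
      exact h (revFlatten_mem_shuffleList _)
  · intro m hm hmm
    rw [Finsupp.smul_apply, sum_map_single_apply, List.count_eq_zero_of_not_mem, Nat.cast_zero,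
      smul_zero]
    intro hmem
    exact hmm (word_inj (le_antisymm (hmax m hm)
      (le_revFlatten_of_mem_shuffleList (fac_lyn m) (fac_sorted m) hmem)))
  · exact fun h => absurd hm₀ h

end AlgebraicIndependence

end NCDiff
namespace NCDiff

namespace NCSeries

/-! ### The ring of noncommutative series -/

section Conc

variable {R X : Type*} [CommRing R]

theorem conc_nil {N : Type*} [AddCommGroup N] [Module R N] (M : NCSeries N X) (S : NCSeries R X) :
    conc M S [] = S [] • M [] := by
  simp [conc]

/-- The recursion of the product along the first letter: the first letter of `x :: w` is the first
letter of the left factor, unless that factor is empty. -/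
theorem conc_cons {N : Type*} [AddCommGroup N] [Module R N] (M : NCSeries N X) (S : NCSeries R X)
    (x : X) (w : List X) :
    conc M S (x :: w) = S (x :: w) • M [] + conc (fun u => M (x :: u)) S w := by
  simp only [conc, List.length_cons]
  rw [Finset.sum_range_succ', add_comm]
  simp

theorem conc_add_left (P Q S : NCSeries R X) : conc (P + Q) S = conc P S + conc Q S := by
  funext w
  simp [conc, mul_add, Finset.sum_add_distrib]

theorem conc_add_right (P S T : NCSeries R X) : conc P (S + T) = conc P S + conc P T := by
  funext w
  simp [conc, add_mul, Finset.sum_add_distrib]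

theorem zero_conc (S : NCSeries R X) : conc (0 : NCSeries R X) S = 0 := by
  funext w
  simp [conc]

theorem conc_zero (S : NCSeries R X) : conc S (0 : NCSeries R X) = 0 := by
  funext w
  simp [conc]

theorem conc_smul_left (a : R) (P S : NCSeries R X) : conc (a • P) S = a • conc P S := by
  funext w
  simp [conc, Finset.mul_sum, mul_left_comm]

theorem conc_assoc (P Q S : NCSeries R X) : conc (conc P Q) S = conc P (conc Q S) := by
  funext w
  induction w generalizing P Q with
  | nil => simp only [conc_nil, smul_eq_mul]; ring
  | cons x w ih =>
    have h : (fun u => conc P Q (x :: u)) =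
        P [] • (fun u => Q (x :: u)) + conc (fun u => P (x :: u)) Q := by
      funext u
      simp [conc_cons, mul_comm]
    rw [conc_cons, h, conc_add_left, conc_smul_left, Pi.add_apply, ih, conc_cons P, conc_cons Q,
      conc_nil]
    simp only [Pi.smul_apply, smul_eq_mul]
    ring

theorem one_conc (S : NCSeries R X) : conc (one : NCSeries R X) S = S := by
  funext w
  cases w with
  | nil => simp [conc_nil, one]
  | cons x w =>
    have h : (fun u : List X => (one : NCSeries R X) (x :: u)) = 0 := rfl
    rw [conc_cons, h]
    simp [one, conc]

theorem conc_one (S : NCSeries R X) : conc S (one : NCSeries R X) = S := by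
  funext w
  induction w generalizing S with
  | nil => simp [conc_nil, one]
  | cons x w ih => simp [conc_cons, ih, one]

end Conc

/-- The ring of noncommutative series for the concatenation product. It is a type synonym of
`NCSeries R X`, whose own multiplication would be the pointwise product of functions on words. -/
def ConcRing (R X : Type*) : Type _ := NCSeries R X

section Ring

variable {R X : Type*} [CommRing R]

instance : AddCommGroup (ConcRing R X) := inferInstanceAs (AddCommGroup (List X → R))

instance : Ring (ConcRing R X) where
  __ := (inferInstance : AddCommGroup (ConcRing R X))
  mul := conc (R := R) (X := X) (N := R)
  one := (one : NCSeries R X)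
  mul_assoc := conc_assoc
  one_mul := one_conc
  mul_one := conc_one
  left_distrib := conc_add_right
  right_distrib := conc_add_left
  zero_mul := zero_conc
  mul_zero := conc_zero

/-- A series seen in the ring of series. -/
def toRing (S : NCSeries R X) : ConcRing R X := S

theorem toRing_pow (S : NCSeries R X) (k : ℕ) : toRing (pow S k) = toRing S ^ k := by
  induction k with
  | zero => rfl
  | succ k ih => rw [pow_succ', ← ih]; rfl

theorem pow_add' (S : NCSeries R X) (k m : ℕ) : pow S (k + m) = conc (pow S k) (pow S m) := by
  change toRing (pow S (k + m)) = toRing (pow S k) * toRing (pow S m)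
  rw [toRing_pow, toRing_pow, toRing_pow, pow_add]

theorem pow_one' (S : NCSeries R X) : pow S 1 = S := conc_one S

theorem pow_apply_eq_zero {S : NCSeries R X} (hS : S [] = 0) {k : ℕ} {w : List X}
    (h : w.length < k) : pow S k w = 0 := by
  induction k generalizing w with
  | zero => simp at h
  | succ k ih =>
    rw [pow, conc]
    refine Finset.sum_eq_zero fun i hi => ?_
    rcases Nat.eq_zero_or_pos i with rfl | hi0
    · simp [hS]
    · rw [ih, zero_smul]
      rw [Finset.mem_range] at hi
      rw [List.length_drop]
      omega

theorem toRing_sum_apply {ι : Type*} (s : Finset ι) (f : ι → ConcRing R X) (w : List X) :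
    (∑ i ∈ s, f i) w = ∑ i ∈ s, f i w :=
  Finset.sum_apply w s (fun i => (f i : List X → R))

theorem toRing_mul_natCast_apply (P : ConcRing R X) (m : ℕ) (w : List X) :
    (P * (m : ConcRing R X)) w = (m : R) * P w := by
  induction m with
  | zero =>
    rw [Nat.cast_zero, mul_zero, Nat.cast_zero, zero_mul]
    rfl
  | succ m ih =>
    rw [Nat.cast_succ, mul_add, mul_one, Nat.cast_succ, add_mul, one_mul, ← ih]
    rfl

/-- The binomial expansion of the powers of `G`, in powers of `G - 1`, at a given word. -/
theorem pow_eq_sum_choose {G : NCSeries R X} (hG : G [] = 1) (m : ℕ) (w : List X) :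
    pow G m w = ∑ k ∈ Finset.range (w.length + 1), (m.choose k : R) * pow (G - one) k w := by
  have h0 : (G - one : NCSeries R X) [] = 0 := by simp [hG, one]
  -- The binomial theorem has `m + 1` terms; those of index beyond `m` or `|w|` vanish.
  have h1 : toRing (pow G m) = ∑ k ∈ Finset.range (m + 1),
      toRing (pow (G - one) k) * (m.choose k : ConcRing R X) := by
    have e : toRing G = toRing (G - one : NCSeries R X) + 1 :=
      (sub_add_cancel (toRing G) (1 : ConcRing R X)).symm
    rw [toRing_pow, e, (Commute.one_right _).add_pow]
    refine Finset.sum_congr rfl fun k _ => ?_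
    rw [one_pow, mul_one, toRing_pow]
  have h2 : pow G m w = ∑ k ∈ Finset.range (m + 1), (m.choose k : R) * pow (G - one) k w := by
    have := congrFun h1 w
    rw [toRing_sum_apply] at this
    refine this.trans (Finset.sum_congr rfl fun k _ => toRing_mul_natCast_apply _ _ _)
  rw [h2]
  rcases le_total m w.length with h | h
  · refine Finset.sum_subset (by simpa using h) fun k _ hk => ?_
    rw [Nat.choose_eq_zero_of_lt (by simpa using hk), Nat.cast_zero, zero_mul]
  · symm
    refine Finset.sum_subset (by simpa using h) fun k _ hk => ?_
    rw [pow_apply_eq_zero h0 (by simpa using hk), mul_zero]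

end Ring

/-! ### The coproduct dual to the shuffle -/

section Coproduct

variable {R X : Type*} [CommRing R]

/-- The coproduct of `S` dual to the shuffle: its coefficient at `u ⊗ v` is `⟨S | u ⧢ v⟩`. -/
def coprod (S : NCSeries R X) (u v : List X) : R := ((shuffle u v).map S).sum

@[simp] theorem coprod_nil_left (S : NCSeries R X) (v : List X) : coprod S [] v = S v := by
  simp [coprod]

@[simp] theorem coprod_nil_right (S : NCSeries R X) (u : List X) : coprod S u [] = S u := by
  simp [coprod]

theorem coprod_cons_cons (S : NCSeries R X) (x y : X) (u v : List X) :
    coprod S (x :: u) (y :: v) =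
      coprod (fun w => S (x :: w)) u (y :: v) + coprod (fun w => S (y :: w)) (x :: u) v := by
  simp [coprod, shuffle_cons_cons, Function.comp_def]

theorem coprod_add (S T : NCSeries R X) (u v : List X) :
    coprod (S + T) u v = coprod S u v + coprod T u v :=
  List.sum_map_add (f := S) (g := T) (l := shuffle u v)

theorem coprod_smul {B : Type*} [Monoid B] [DistribMulAction B R] (a : B) (S : NCSeries R X)
    (u v : List X) : coprod (a • S) u v = a • coprod S u v := by
  simp only [coprod, List.smul_sum, List.map_map]
  rfl

theorem coprod_congr {S T : NCSeries R X} {u v : List X}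
    (h : ∀ w, w.length = u.length + v.length → S w = T w) : coprod S u v = coprod T u v := by
  unfold coprod
  congr 1
  exact List.map_congr_left fun w hw => h w (length_of_mem_shuffle hw)

theorem coprod_map {R' : Type*} [CommRing R'] (φ : R →+ R') (S : NCSeries R X) (u v : List X) :
    coprod (fun w => φ (S w)) u v = φ (coprod S u v) := by
  simp [coprod, map_list_sum, Function.comp_def]

theorem coprod_sum {ι : Type*} (s : Finset ι) (f : ι → NCSeries R X) (u v : List X) :
    coprod (fun w => ∑ i ∈ s, f i w) u v = ∑ i ∈ s, coprod (f i) u v := by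
  classical
  induction s using Finset.induction_on with
  | empty => simp [coprod]
  | insert i s hi ih =>
    simp only [Finset.sum_insert hi]
    rw [← ih, ← coprod_add]
    rfl

theorem isGrouplike_iff {S : NCSeries R X} :
    S.IsGrouplike ↔ S [] = 1 ∧ ∀ u v, coprod S u v = S u * S v := Iff.rfl

/-- The product, for concatenation in both tensor factors, of two functions of pairs of words. -/
def conc₂ (T T' : List X → List X → R) (u v : List X) : R :=
  ∑ i ∈ Finset.range (u.length + 1), ∑ j ∈ Finset.range (v.length + 1),
    T (u.take i) (v.take j) * T' (u.drop i) (v.drop j)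

/-- The coproduct is multiplicative. The induction removes the first letters of both words, with the
recursions `conc_cons` and `coprod_cons_cons`. -/
theorem coprod_conc (P Q : NCSeries R X) (u v : List X) :
    coprod (conc P Q) u v = conc₂ (coprod P) (coprod Q) u v := by
  induction u generalizing P v with
  | nil => simp [conc₂, conc, mul_comm]
  | cons x u ihu =>
    induction v generalizing P with
    | nil => simp [conc₂, conc, mul_comm]
    | cons y v ihv =>
      have h (z : X) : (fun w => conc P Q (z :: w)) =
          P [] • (fun w => Q (z :: w)) + conc (fun w => P (z :: w)) Q := by
        funext w
        simp [conc_cons, mul_comm]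
      rw [coprod_cons_cons, h, h, coprod_add, coprod_add, coprod_smul, coprod_smul, ihu, ihv]
      simp only [conc₂, List.length_cons, Finset.sum_range_succ' _ (u.length + 1),
        Finset.sum_range_succ' _ (v.length + 1), List.take_succ_cons, List.drop_succ_cons,
        List.take_zero, List.drop_zero, coprod_nil_left, coprod_nil_right, coprod_cons_cons P,
        coprod_cons_cons Q, add_mul, Finset.sum_add_distrib, smul_eq_mul]
      ring

theorem isGrouplike_conc {P Q : NCSeries R X} (hP : P.IsGrouplike) (hQ : Q.IsGrouplike) :
    (conc P Q).IsGrouplike := by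
  rw [isGrouplike_iff] at *
  refine ⟨by simp [conc_nil, hP.1, hQ.1], fun u v => ?_⟩
  rw [coprod_conc]
  simp only [conc₂, hP.2, hQ.2, NCSeries.conc, Finset.sum_mul_sum, smul_eq_mul]
  exact Finset.sum_congr rfl fun i _ => Finset.sum_congr rfl fun j _ => by ring

theorem isGrouplike_one : (one : NCSeries R X).IsGrouplike := by
  rw [isGrouplike_iff]
  refine ⟨rfl, fun u v => ?_⟩
  cases u with
  | nil => simp [one]
  | cons x u =>
    have h : ∀ w : List X, w.length = (x :: u).length + v.length →
        (one : NCSeries R X) w = (0 : NCSeries R X) w := by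
      intro w hw
      cases w with
      | nil => simp at hw; omega
      | cons => rfl
    rw [coprod_congr h]
    simp [coprod, one, Pi.zero_def]

theorem isGrouplike_pow {G : NCSeries R X} (hG : G.IsGrouplike) (m : ℕ) :
    (pow G m).IsGrouplike := by
  induction m with
  | zero => exact isGrouplike_one
  | succ m ih => exact isGrouplike_conc hG ih

/-- Primitive series for the coproduct dual to the shuffle: they have no constant term and vanish
on the shuffles of nonempty words. -/
def IsPrimitive (C : NCSeries R X) : Prop :=
  C [] = 0 ∧ ∀ u v : List X, u ≠ [] → v ≠ [] → coprod C u v = 0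

theorem IsPrimitive.coprod_eq [DecidableEq X] {C : NCSeries R X} (hC : C.IsPrimitive)
    (u v : List X) :
    coprod C u v = (if v = [] then C u else 0) + if u = [] then C v else 0 := by
  by_cases hu : u = []
  · by_cases hv : v = []
    · simp [hu, hv, hC.1]
    · simp [hu, hv]
  · by_cases hv : v = []
    · simp [hu, hv]
    · simp [hu, hv, hC.2]

/-- The coproduct of a product whose first factor is primitive. -/
theorem IsPrimitive.coprod_conc_left {C : NCSeries R X} (hC : C.IsPrimitive) (Q : NCSeries R X)
    (u v : List X) :
    coprod (NCSeries.conc C Q) u v =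
      NCSeries.conc C (fun u' => coprod Q u' v) u + NCSeries.conc C (fun v' => coprod Q u v') v := by
  classical
  rw [NCSeries.coprod_conc]
  simp only [conc₂, hC.coprod_eq, add_mul, Finset.sum_add_distrib, NCSeries.conc, ite_mul, zero_mul,
    smul_eq_mul]
  congr 1
  · refine Finset.sum_congr rfl fun i _ => ?_
    rw [Finset.sum_eq_single 0]
    · simp [mul_comm]
    · intro j hj hj0
      rw [if_neg]
      cases v <;> simp_all
    · simp
  · rw [Finset.sum_eq_single 0]
    · exact Finset.sum_congr rfl fun i _ => by simp [mul_comm]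
    · intro i hi hi0
      refine Finset.sum_eq_zero fun j _ => ?_
      rw [if_neg]
      cases u <;> simp_all
    · simp

theorem conc_of_forall_ne_nil {P Q : NCSeries R X} (hQ : ∀ w, w ≠ [] → Q w = 0) (u : List X) :
    conc P Q u = P u * Q [] := by
  rw [conc, Finset.sum_eq_single u.length]
  · simp [mul_comm]
  · intro i hi hne
    rw [hQ, zero_smul]
    simp only [Finset.mem_range] at hi
    simp only [ne_eq, List.drop_eq_nil_iff]
    omega
  · simp

/-- Primitive series are closed under brackets: the coproduct of `P Q` at nonempty words `u`, `v` is
`P u * Q v + P v * Q u`, which is symmetric in `P` and `Q`. -/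
theorem IsPrimitive.commutator {P Q : NCSeries R X} (hP : P.IsPrimitive) (hQ : Q.IsPrimitive) :
    (conc P Q - conc Q P).IsPrimitive := by
  refine ⟨by simp [conc_nil, hP.1, hQ.1], fun u v hu hv => ?_⟩
  have key {P Q : NCSeries R X} (hP : P.IsPrimitive) (hQ : Q.IsPrimitive) :
      coprod (conc P Q) u v = P u * Q v + P v * Q u := by
    rw [hP.coprod_conc_left, conc_of_forall_ne_nil, conc_of_forall_ne_nil]
    · simp
    · exact fun w hw => hQ.2 u w hu hw
    · exact fun w hw => hQ.2 w v hw hv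
  have : conc P Q - conc Q P = conc P Q + (-1 : R) • conc Q P := by simp [sub_eq_add_neg]
  rw [this, coprod_add, coprod_smul, key hP hQ, key hQ hP, smul_eq_mul]
  ring

end Coproduct

/-! ### Exponential and logarithm -/

open Polynomial in
theorem eq_of_forall_natCast_eval {R : Type*} [CommRing R] [IsDomain R] [CharZero R] {p q : R[X]}
    (h : ∀ m : ℕ, p.eval (m : R) = q.eval (m : R)) : p = q :=
  eq_of_infinite_eval_eq p q (Set.infinite_of_injective_forall_mem (f := ((↑) : ℕ → R))
    Nat.cast_injective h)

section Exp

open Finset.HasAntidiagonal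

variable {R X : Type*} [CommRing R] [Algebra ℂ R]

/-- The divided powers `C ^ k / k!`. -/
noncomputable def divPow (C : NCSeries R X) (k : ℕ) : NCSeries R X :=
  ((k.factorial : ℂ)⁻¹) • pow C k

theorem divPow_zero (C : NCSeries R X) : divPow C 0 = one := by simp [divPow, pow]

/-- The recurrence `C · (C ^ k / k!) = (k + 1) (C ^ (k + 1) / (k + 1)!)`. -/
theorem conc_divPow (C : NCSeries R X) (k : ℕ) (w : List X) :
    conc C (divPow C k) w = ((k : R) + 1) * divPow C (k + 1) w := by
  have h1 : conc C (divPow C k) = ((k.factorial : ℂ)⁻¹) • pow C (k + 1) := by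
    funext w
    simp [pow, conc, divPow, Finset.smul_sum]
  have h2 : ((k : R) + 1) = algebraMap ℂ R (k + 1) := by simp
  rw [h1, h2, ← Algebra.smul_def, divPow, Pi.smul_apply, Pi.smul_apply, smul_smul]
  congr 1
  have : (k.factorial : ℂ) ≠ 0 := by exact_mod_cast k.factorial_ne_zero
  have : (k + 1 : ℂ) ≠ 0 := by exact_mod_cast k.succ_ne_zero
  push_cast [Nat.factorial_succ]
  field_simp

theorem divPow_apply_eq_zero {C : NCSeries R X} (hC : C [] = 0) {k : ℕ} {w : List X}
    (h : w.length < k) : divPow C k w = 0 := by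
  rw [divPow, Pi.smul_apply, pow_apply_eq_zero hC h, smul_zero]

/-- The divided powers are the unique solution of their recurrence. -/
theorem eq_divPow_of_recurrence [IsDomain R] [CharZero R] {C : NCSeries R X}
    {F : ℕ → NCSeries R X} (h0 : F 0 = one)
    (h : ∀ (k : ℕ) (w : List X), ((k : R) + 1) * F (k + 1) w = conc C (F k) w) (k : ℕ) :
    F k = divPow C k := by
  induction k with
  | zero => rw [h0, divPow_zero]
  | succ k ih =>
    funext w
    have hk : (k : R) + 1 ≠ 0 := by exact_mod_cast k.succ_ne_zero
    apply mul_left_cancel₀ hk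
    rw [h, ih, conc_divPow]

/-- The divided powers of a primitive series form a divided power sequence for the coproduct. -/
theorem IsPrimitive.coprod_divPow [IsDomain R] [CharZero R] {C : NCSeries R X}
    (hC : C.IsPrimitive) (k : ℕ) (u v : List X) :
    coprod (divPow C k) u v = ∑ ij ∈ antidiagonal k, divPow C ij.1 u * divPow C ij.2 v := by
  induction k generalizing u v with
  | zero =>
    simp only [divPow_zero, Finset.Nat.antidiagonal_zero, Finset.sum_singleton]
    exact isGrouplike_one.2 u v
  | succ k ih =>
    have hk : (k : R) + 1 ≠ 0 := by exact_mod_cast k.succ_ne_zero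
    apply mul_left_cancel₀ hk
    have h1 : ((k : R) + 1) * coprod (divPow C (k + 1)) u v =
        coprod (NCSeries.conc C (divPow C k)) u v := by
      rw [← smul_eq_mul, ← coprod_smul]
      congr 1
      funext w
      rw [conc_divPow]
      rfl
    have hl (T : ℕ → R) (w : List X) :
        NCSeries.conc C (fun w' => ∑ ij ∈ antidiagonal k, divPow C ij.1 w' * T ij.2) w =
        ∑ ij ∈ antidiagonal k, ((ij.1 : R) + 1) * divPow C (ij.1 + 1) w * T ij.2 := by
      simp only [← conc_divPow, NCSeries.conc, smul_eq_mul, Finset.sum_mul]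
      rw [Finset.sum_comm]
      exact Finset.sum_congr rfl fun i _ => Finset.sum_congr rfl fun j _ => by ring
    have hr (T : ℕ → R) (w : List X) :
        NCSeries.conc C (fun w' => ∑ ij ∈ antidiagonal k, T ij.1 * divPow C ij.2 w') w =
        ∑ ij ∈ antidiagonal k, T ij.1 * (((ij.2 : R) + 1) * divPow C (ij.2 + 1) w) := by
      simp only [← conc_divPow, NCSeries.conc, smul_eq_mul, Finset.sum_mul, Finset.mul_sum]
      rw [Finset.sum_comm]
      exact Finset.sum_congr rfl fun i _ => Finset.sum_congr rfl fun j _ => by ring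
    have h2 : ((k : R) + 1) * ∑ ij ∈ antidiagonal (k + 1),
          divPow C ij.1 u * divPow C ij.2 v =
        (∑ ij ∈ antidiagonal (k + 1), (ij.1 : R) * divPow C ij.1 u * divPow C ij.2 v) +
        ∑ ij ∈ antidiagonal (k + 1), divPow C ij.1 u * ((ij.2 : R) * divPow C ij.2 v) := by
      rw [Finset.mul_sum, ← Finset.sum_add_distrib]
      refine Finset.sum_congr rfl fun ij hij => ?_
      have : (k : R) + 1 = ij.1 + ij.2 := by
        rw [mem_antidiagonal] at hij
        exact_mod_cast hij.symm
      rw [this]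
      ring
    rw [h1, hC.coprod_conc_left, h2]
    simp only [ih]
    rw [hl (fun j => divPow C j v), hr (fun i => divPow C i u),
      Finset.Nat.sum_antidiagonal_succ, Finset.Nat.sum_antidiagonal_succ']
    simp

open Polynomial in
/-- The exponential of a primitive series is grouplike. -/
theorem IsPrimitive.exp_isGrouplike [IsDomain R] [CharZero R] {C : NCSeries R X}
    (hC : C.IsPrimitive) : (exp C).IsGrouplike := by
  -- The polynomial `∑ ⟨C ^ k / k! | w⟩ T ^ k` keeps track of the truncation at `w`.
  let E : List X → R[X] := fun w =>
    ∑ k ∈ Finset.range (w.length + 1), monomial k (divPow C k w)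
  have hE (w : List X) (k : ℕ) : (E w).coeff k = divPow C k w := by
    simp only [E, finsetSum_coeff, coeff_monomial]
    rw [Finset.sum_ite_eq']
    split_ifs with h
    · rfl
    · rw [divPow_apply_eq_zero hC.1]
      simpa using h
  have hexp (w : List X) : exp C w = (E w).eval 1 := by
    simp [E, exp, divPow, eval_finsetSum]
  refine ⟨by simp [exp, pow, one], fun u v => ?_⟩
  have h : coprod E u v = E u * E v := by
    ext k
    rw [coeff_mul, ← lcoeff_apply, ← LinearMap.toAddMonoidHom_coe, ← coprod_map]
    simp only [LinearMap.toAddMonoidHom_coe, lcoeff_apply, hE]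
    exact hC.coprod_divPow k u v
  rw [hexp, hexp, ← eval_mul, ← h, ← coe_evalRingHom]
  have := coprod_map (evalRingHom (1 : R)).toAddMonoidHom E u v
  refine Eq.trans ?_ this
  unfold coprod
  congr 2
  funext w
  exact hexp w

end Exp

section Log

open Polynomial

variable {R Y : Type*} [CommRing R] [Algebra ℂ R]

/-- The polynomial in `m` interpolating the coefficient of the word `w` in the power `G ^ m` of a
series `G` with constant term `1`, by the binomial expansion. -/
noncomputable def powPoly (G : NCSeries R Y) (w : List Y) : R[X] :=
  ∑ k ∈ Finset.range (w.length + 1),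
    Polynomial.C (algebraMap ℂ R (k.factorial : ℂ)⁻¹ * pow (G - one) k w) * descPochhammer R k

theorem powPoly_eval {G : NCSeries R Y} (hG : G [] = 1) (w : List Y) (m : ℕ) :
    (powPoly G w).eval (m : R) = pow G m w := by
  rw [pow_eq_sum_choose hG, powPoly, eval_finsetSum]
  refine Finset.sum_congr rfl fun k _ => ?_
  rw [eval_mul, eval_C, descPochhammer_eval_eq_descFactorial,
    Nat.descFactorial_eq_factorial_mul_choose]
  have : algebraMap ℂ R (k.factorial : ℂ)⁻¹ * (k.factorial : R) = 1 := by
    rw [← map_natCast (algebraMap ℂ R), ← map_mul, inv_mul_cancel₀, map_one]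
    exact_mod_cast k.factorial_ne_zero
  push_cast
  linear_combination (pow (G - one) k w * (m.choose k : R)) * this

/-- The logarithm of a series with constant term `1`: the derivative at `m = 0` of the
interpolated powers `G ^ m`. -/
noncomputable def log (G : NCSeries R Y) : NCSeries R Y := fun w => (powPoly G w).coeff 1

theorem powPoly_coeff_zero {G : NCSeries R Y} (hG : G [] = 1) (w : List Y) :
    (powPoly G w).coeff 0 = (one : NCSeries R Y) w := by
  have h := powPoly_eval hG w 0
  rwa [Nat.cast_zero, ← coeff_zero_eq_eval_zero] at h

variable [IsDomain R] [CharZero R]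

theorem powPoly_nil {G : NCSeries R Y} (hG : G.IsGrouplike) : powPoly G [] = 1 :=
  eq_of_forall_natCast_eval fun m => by rw [powPoly_eval hG.1, (isGrouplike_pow hG m).1, eval_one]

theorem powPoly_mul {G : NCSeries R Y} (hG : G.IsGrouplike) (u v : List Y) :
    coprod (powPoly G) u v = powPoly G u * powPoly G v := by
  refine eq_of_forall_natCast_eval fun m => ?_
  rw [eval_mul, powPoly_eval hG.1, powPoly_eval hG.1, ← (isGrouplike_pow hG m).2, ← coe_evalRingHom]
  refine (coprod_map (evalRingHom (m : R)).toAddMonoidHom (powPoly G) u v).symm.trans ?_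
  unfold coprod
  congr 2
  funext w
  exact powPoly_eval hG.1 w m

/-- A grouplike series is invertible for concatenation, with grouplike inverse: the inverse is the
interpolated power of exponent `-1`. -/
theorem IsGrouplike.exists_inverse {G : NCSeries R Y} (hG : G.IsGrouplike) :
    ∃ G' : NCSeries R Y, G'.IsGrouplike ∧ conc G G' = one ∧ conc G' G = one := by
  refine ⟨fun w => (powPoly G w).eval (-1), ⟨?_, fun u v => ?_⟩, ?_, ?_⟩
  · simp [powPoly_nil hG]
  · rw [← eval_mul, ← powPoly_mul hG, ← coe_evalRingHom]
    exact coprod_map (evalRingHom (-1 : R)).toAddMonoidHom (powPoly G) u v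
  · funext w
    -- `G ^ (m + 1) = G · G ^ m` as polynomials in `m`, to be evaluated at `m = -1`.
    have h : (powPoly G w).comp (X + 1) = ∑ k ∈ Finset.range (w.length + 1),
        powPoly G (w.drop k) * Polynomial.C (G (w.take k)) := by
      refine eq_of_forall_natCast_eval fun m => ?_
      have e : ((m : R) + 1) = ((m + 1 : ℕ) : R) := by push_cast; rfl
      simp only [eval_comp, eval_add, eval_X, eval_one, eval_finsetSum, eval_mul, eval_C, e,
        powPoly_eval hG.1]
      rfl
    have h2 := congrArg (eval (-1)) h
    rw [eval_comp, eval_add, eval_X, eval_one, neg_add_cancel, eval_finsetSum] at h2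
    simp only [eval_mul, eval_C] at h2
    have h3 := powPoly_eval hG.1 w 0
    rw [Nat.cast_zero] at h3
    exact h2.symm.trans h3
  · funext w
    -- `G ^ (m + 1) = G ^ m · G` as polynomials in `m`, to be evaluated at `m = -1`.
    have h : (powPoly G w).comp (X + 1) = ∑ k ∈ Finset.range (w.length + 1),
        Polynomial.C (G (w.drop k)) * powPoly G (w.take k) := by
      refine eq_of_forall_natCast_eval fun m => ?_
      have e : ((m : R) + 1) = ((m + 1 : ℕ) : R) := by push_cast; rfl
      simp only [eval_comp, eval_add, eval_X, eval_one, eval_finsetSum, eval_mul, eval_C, e,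
        powPoly_eval hG.1]
      rw [pow_add', pow_one']
      rfl
    have h2 := congrArg (eval (-1)) h
    rw [eval_comp, eval_add, eval_X, eval_one, neg_add_cancel, eval_finsetSum] at h2
    simp only [eval_mul, eval_C] at h2
    have h3 := powPoly_eval hG.1 w 0
    rw [Nat.cast_zero] at h3
    exact h2.symm.trans h3

/-- At nonempty words `u`, `v` the polynomials `powPoly G u` and `powPoly G v` have no constant term,
so that their product has no linear term. -/
theorem IsGrouplike.log_isPrimitive {G : NCSeries R Y} (hG : G.IsGrouplike) :
    (log G).IsPrimitive := by
  refine ⟨by simp [log, powPoly_nil hG, coeff_one], fun u v hu hv => ?_⟩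
  have h := congrArg (fun p => p.coeff 1) (powPoly_mul hG u v)
  have h0 (w : List Y) (hw : w ≠ []) : (powPoly G w).coeff 0 = 0 := by
    rw [powPoly_coeff_zero hG.1]
    cases w
    · exact absurd rfl hw
    · rfl
  simp only [mul_coeff_one, h0 u hu, h0 v hv, zero_mul, mul_zero, zero_add] at h
  refine (coprod_map (lcoeff R 1).toAddMonoidHom (powPoly G) u v).trans h

/-- The polynomials `powPoly G` solve the differential equation of the exponential of
`m • log G`. -/
theorem derivative_powPoly {G : NCSeries R Y} (hG : G [] = 1) (w : List Y) :
    derivative (powPoly G w) = ∑ k ∈ Finset.range (w.length + 1),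
      powPoly G (w.drop k) * Polynomial.C (log G (w.take k)) := by
  refine eq_of_forall_natCast_eval fun m => ?_
  -- Both sides agree at every natural number `m`: differentiate `G ^ (s + m) = G ^ s · G ^ m` in `s`
  -- at `s = 0`.
  have h : (powPoly G w).comp (X + Polynomial.C (m : R)) = ∑ k ∈ Finset.range (w.length + 1),
      Polynomial.C (pow G m (w.drop k)) * powPoly G (w.take k) := by
    refine eq_of_forall_natCast_eval fun s => ?_
    have e : ((s : R) + m) = ((s + m : ℕ) : R) := by push_cast; rfl
    simp only [eval_comp, eval_add, eval_X, eval_finsetSum, eval_mul, eval_C, e,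
      powPoly_eval hG]
    rw [pow_add']
    rfl
  have h2 := congrArg (fun p => eval 0 (derivative p)) h
  simp only [derivative_comp, derivative_add, derivative_X, derivative_C, add_zero, eval_mul,
    one_mul, eval_comp, eval_add, eval_X, eval_C, zero_add, derivative_sum,
    eval_finsetSum, derivative_C_mul] at h2
  rw [h2, eval_finsetSum]
  refine Finset.sum_congr rfl fun k _ => ?_
  rw [eval_mul, eval_C, powPoly_eval hG, log]
  congr 1
  rw [← coeff_zero_eq_eval_zero, coeff_derivative]
  simp

/-- The coefficients of the interpolated powers are the divided powers of the logarithm. -/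
theorem powPoly_coeff {G : NCSeries R Y} (hG : G [] = 1) (k : ℕ) (w : List Y) :
    (powPoly G w).coeff k = divPow (log G) k w := by
  refine congrFun (eq_divPow_of_recurrence (F := fun (k : ℕ) w => (powPoly G w).coeff k) ?_ ?_ k) w
  · funext w
    exact powPoly_coeff_zero hG w
  · intro k w
    have h := congrArg (fun p => p.coeff k) (derivative_powPoly hG w)
    simp only [coeff_derivative, finsetSum_coeff, coeff_mul_C] at h
    rw [mul_comm, h]
    rfl

/-- Evaluate the interpolated powers at `m = 1`. -/
theorem IsGrouplike.exp_log {G : NCSeries R Y} (hG : G.IsGrouplike) : exp (log G) = G := by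
  funext w
  have h := powPoly_eval hG.1 w 1
  rw [Nat.cast_one, pow_one', eval_eq_sum_range' (n := w.length + 1)] at h
  · rw [← h, exp]
    refine Finset.sum_congr rfl fun k _ => ?_
    rw [one_pow, mul_one, powPoly_coeff hG.1]
    rfl
  · rw [Nat.lt_succ_iff, natDegree_le_iff_coeff_eq_zero]
    intro k hk
    rw [powPoly_coeff hG.1, divPow_apply_eq_zero hG.log_isPrimitive.1 hk]

end Log

end NCSeries

end NCDiff
namespace NCDiff

namespace NCSeries

/-! ### Lie polynomials are primitive -/

section LiePolynomial

attribute [local instance] LieRing.ofAssociativeRing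

variable {R X : Type*} [CommRing R]

/-- The coefficients of a noncommutative polynomial, as a series. -/
def ofPoly (P : MonoidAlgebra R (FreeMonoid X)) : NCSeries R X :=
  fun w => P.coeff (FreeMonoid.ofList w)

/-- The polynomial given by the word `w`. -/
noncomputable def word (R : Type*) [CommRing R] (w : List X) : MonoidAlgebra R (FreeMonoid X) :=
  MonoidAlgebra.of R (FreeMonoid X) (FreeMonoid.ofList w)

theorem word_append (u v : List X) : word R (u ++ v) = word R u * word R v := by
  rw [word, FreeMonoid.ofList_append, map_mul]
  rfl

theorem word_nil : word R ([] : List X) = 1 := map_one (MonoidAlgebra.of R (FreeMonoid X))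

theorem coeff_word [DecidableEq X] (u v : List X) :
    (word R u).coeff (FreeMonoid.ofList v) = if u = v then 1 else 0 := by
  classical
  rw [word, MonoidAlgebra.of_apply, MonoidAlgebra.coeff_single, Finsupp.single_apply]
  simp only [EmbeddingLike.apply_eq_iff_eq]

/-- The product of two monomials, as series. -/
theorem conc_ite [DecidableEq X] (u v : List X) (a b : R) :
    conc (fun w => if u = w then a else 0) (fun w => if v = w then b else 0) =
      fun w : List X => if u ++ v = w then a * b else 0 := by
  induction u with
  | nil =>
    funext w
    rw [conc, Finset.sum_eq_single 0]
    · simp [mul_comm]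
    · intro i hi hi0
      have : [] ≠ w.take i := by
        intro h
        rw [eq_comm, List.take_eq_nil_iff] at h
        rcases h with rfl | rfl <;> simp_all
      simp [this]
    · simp
  | cons x u ih =>
    funext w
    cases w with
    | nil => simp [conc_nil]
    | cons y w =>
      rw [conc_cons]
      by_cases h : x = y
      · subst h
        simp [ih]
      · have : (fun t : List X => if x :: u = y :: t then a else 0) = 0 := by
          funext t
          simp [h]
        rw [this, zero_conc]
        simp [h]

theorem ofPoly_mul (P Q : MonoidAlgebra R (FreeMonoid X)) :
    ofPoly (P * Q) = conc (ofPoly P) (ofPoly Q) := by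
  classical
  have hadd (P Q : MonoidAlgebra R (FreeMonoid X)) : ofPoly (P + Q) = ofPoly P + ofPoly Q := rfl
  have h0 : ofPoly (0 : MonoidAlgebra R (FreeMonoid X)) = 0 := rfl
  have hs (u : FreeMonoid X) (a : R) : ofPoly (MonoidAlgebra.single u a) =
      fun w => if u.toList = w then a else 0 := by
    funext w
    rw [ofPoly, MonoidAlgebra.coeff_single, Finsupp.single_apply]
    exact if_congr Iff.rfl rfl rfl
  induction P using MonoidAlgebra.induction_linear with
  | zero => rw [zero_mul, h0, zero_conc]
  | add P P' h h' => rw [add_mul, hadd, hadd, conc_add_left, h, h']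
  | single u a =>
    induction Q using MonoidAlgebra.induction_linear with
    | zero => rw [mul_zero, h0, conc_zero]
    | add P P' h h' => rw [mul_add, hadd, hadd, conc_add_right, h, h']
    | single v b =>
      rw [MonoidAlgebra.single_mul_single, hs, hs, hs, conc_ite, FreeMonoid.toList_mul]

/-- Lie polynomials are primitive: the letters are, and primitivity is preserved by linear
combinations and brackets. -/
theorem isPrimitive_ofPoly {P : MonoidAlgebra R (FreeMonoid X)}
    (hP : P ∈ LieSubalgebra.lieSpan R (MonoidAlgebra R (FreeMonoid X))
      (Set.range fun x : X => MonoidAlgebra.of R (FreeMonoid X) (FreeMonoid.of x))) :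
    (ofPoly P).IsPrimitive := by
  classical
  induction hP using LieSubalgebra.lieSpan_induction with
  | mem P h =>
    obtain ⟨x, rfl⟩ := h
    have h (w : List X) : ofPoly (MonoidAlgebra.of R (FreeMonoid X) (FreeMonoid.of x)) w =
        if [x] = w then 1 else 0 := coeff_word [x] w
    refine ⟨by rw [h]; simp, fun u v hu hv => ?_⟩
    rw [coprod_congr (T := (0 : NCSeries R X))]
    · exact coprod_sum (∅ : Finset X) (fun _ => 0) u v
    · intro w hw
      rw [h, if_neg, Pi.zero_apply]
      rintro rfl
      have := List.length_pos_iff.2 hu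
      have := List.length_pos_iff.2 hv
      simp at hw
      omega
  | zero => exact ⟨rfl, fun u v _ _ => coprod_sum (∅ : Finset X) (fun _ => 0) u v⟩
  | add P Q _ _ hP hQ =>
    have e : ofPoly (P + Q) = ofPoly P + ofPoly Q := rfl
    refine ⟨by rw [e, Pi.add_apply, hP.1, hQ.1, add_zero], fun u v hu hv => ?_⟩
    rw [e, coprod_add, hP.2 u v hu hv, hQ.2 u v hu hv, add_zero]
  | smul a P _ hP =>
    have e : ofPoly (a • P) = a • ofPoly P := rfl
    refine ⟨by rw [e, Pi.smul_apply, hP.1, smul_zero], fun u v hu hv => ?_⟩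
    rw [e, coprod_smul, hP.2 u v hu hv, smul_zero]
  | lie P Q _ _ hP hQ =>
    have e : ofPoly ⁅P, Q⁆ = conc (ofPoly P) (ofPoly Q) - conc (ofPoly Q) (ofPoly P) := by
      rw [LieRing.of_associative_ring_bracket, ← ofPoly_mul, ← ofPoly_mul]
      rfl
    rw [e]
    exact hP.commutator hQ

theorem IsLieSeries.isPrimitive {C : NCSeries R X} (hC : C.IsLieSeries) : C.IsPrimitive := by
  have key (k : ℕ) : ∃ Q : NCSeries R X, Q.IsPrimitive ∧ ∀ w, w.length = k → C w = Q w := by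
    obtain ⟨P, hP, h⟩ := hC k
    refine ⟨ofPoly P, isPrimitive_ofPoly hP, fun w hw => ?_⟩
    have := h (FreeMonoid.ofList w)
    rw [FreeMonoid.toList_ofList, if_pos hw] at this
    exact this.symm
  refine ⟨?_, fun u v hu hv => ?_⟩
  · obtain ⟨Q, hQ, h⟩ := key 0
    rw [h [] rfl, hQ.1]
  · obtain ⟨Q, hQ, h⟩ := key (u.length + v.length)
    rw [coprod_congr h, hQ.2 u v hu hv]

end LiePolynomial

/-! ### Sums over the words of a given length -/

section WordSum

variable {X M : Type*} [Fintype X] [AddCommMonoid M]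

/-- The sum of `f w` over all words `w` of length `k`. -/
def wordSum : ℕ → (List X → M) → M
  | 0, f => f []
  | k + 1, f => ∑ x, wordSum k fun w => f (x :: w)

theorem wordSum_congr {k : ℕ} {f g : List X → M} (h : ∀ w, w.length = k → f w = g w) :
    wordSum k f = wordSum k g := by
  induction k generalizing f g with
  | zero => exact h [] rfl
  | succ k ih =>
    exact Finset.sum_congr rfl fun x _ => ih fun w hw => h (x :: w) (by simp [hw])

theorem wordSum_add (k : ℕ) (f g : List X → M) :
    wordSum k (fun w => f w + g w) = wordSum k f + wordSum k g := by
  induction k generalizing f g with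
  | zero => rfl
  | succ k ih => simp only [wordSum, ih, Finset.sum_add_distrib]

theorem wordSum_zero (k : ℕ) : wordSum k (fun _ : List X => (0 : M)) = 0 := by
  induction k with
  | zero => rfl
  | succ k ih => simp only [wordSum, ih, Finset.sum_const_zero]

theorem wordSum_sum {ι : Type*} (s : Finset ι) (k : ℕ) (f : ι → List X → M) :
    wordSum k (fun w => ∑ i ∈ s, f i w) = ∑ i ∈ s, wordSum k (f i) := by
  induction k generalizing f with
  | zero => rfl
  | succ k ih =>
    simp only [wordSum, ih]
    exact Finset.sum_comm

theorem map_wordSum {M' : Type*} [AddCommMonoid M'] (φ : M →+ M') (k : ℕ) (f : List X → M) :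
    φ (wordSum k f) = wordSum k fun w => φ (f w) := by
  induction k generalizing f with
  | zero => rfl
  | succ k ih => simp only [wordSum, map_sum, ih]

theorem wordSum_append (i j : ℕ) (f : List X → M) :
    wordSum i (fun a => wordSum j fun b => f (a ++ b)) = wordSum (i + j) f := by
  induction i generalizing f with
  | zero => simp [wordSum]
  | succ i ih =>
    rw [Nat.succ_add]
    simp only [wordSum, List.cons_append]
    exact Finset.sum_congr rfl fun x _ => ih fun w => f (x :: w)

theorem wordSum_reverse (k : ℕ) (f : List X → M) :
    wordSum k (fun w => f w.reverse) = wordSum k f := by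
  induction k generalizing f with
  | zero => rfl
  | succ k ih =>
    rw [← wordSum_append k 1 f]
    simp only [wordSum, List.reverse_cons]
    rw [wordSum_sum]
    exact Finset.sum_congr rfl fun x _ => ih fun w => f (w ++ [x])

theorem wordSum_ite [DecidableEq X] (k : ℕ) (v : List X) (g : List X → M) :
    wordSum k (fun w => if w = v then g w else 0) = if v.length = k then g v else 0 := by
  induction k generalizing v g with
  | zero => cases v <;> simp [wordSum]
  | succ k ih =>
    cases v with
    | nil =>
      have : wordSum (k + 1) (fun w => if w = [] then g w else 0) =
          wordSum (k + 1) fun _ : List X => (0 : M) := by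
        refine wordSum_congr fun w hw => ?_
        rw [if_neg]
        rintro rfl
        simp at hw
      rw [this, wordSum_zero]
      simp
    | cons y v =>
      rw [wordSum, Finset.sum_eq_single y]
      · simp [ih v fun w => g (y :: w)]
      · intro x _ hx
        simp [hx, wordSum_zero]
      · simp

end WordSum

/-! ### Primitive series are Lie series -/

section Dynkin

open Finset.HasAntidiagonal

attribute [local instance] LieRing.ofAssociativeRing

variable {R X : Type*} [CommRing R]

/-- For a primitive series, a word `x (a ⧢ b)` may be replaced by the single word made of the reverse
of `a`, the letter `x` and `b`, up to the sign `(-1) ^ |a|`: moving one letter at a time from `a` to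
`b` changes the sign, because `(y a) ⧢ (x b)` is killed. -/
theorem IsPrimitive.coprod_shift {C : NCSeries R X} (hC : C.IsPrimitive) (x : X) (a b : List X) :
    coprod (fun w => C (x :: w)) a b = (-1) ^ a.length * C (a.reverse ++ x :: b) := by
  induction a generalizing x b with
  | nil => simp
  | cons y a ih =>
    have h := hC.2 (y :: a) (x :: b) (by simp) (by simp)
    rw [coprod_cons_cons, ih y (x :: b)] at h
    rw [eq_neg_of_add_eq_zero_right h]
    simp [pow_succ]

variable [Fintype X]

/-- The sum of `⟨C | w⟩ [⋯[[Q, x₁], x₂], ⋯, x_k]` over the words `w = x₁ ⋯ x_k` of length `k`. -/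
noncomputable def bracketSum : ℕ → NCSeries R X → MonoidAlgebra R (FreeMonoid X) →
    MonoidAlgebra R (FreeMonoid X)
  | 0, C, Q => C [] • Q
  | k + 1, C, Q => ∑ x, bracketSum k (fun w => C (x :: w)) ⁅Q, word R [x]⁆

theorem bracketSum_mem (L : LieSubalgebra R (MonoidAlgebra R (FreeMonoid X)))
    (hL : ∀ x : X, word R [x] ∈ L) (k : ℕ) (C : NCSeries R X)
    {Q : MonoidAlgebra R (FreeMonoid X)} (hQ : Q ∈ L) : bracketSum k C Q ∈ L := by
  induction k generalizing C Q with
  | zero => exact L.smul_mem _ hQ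
  | succ k ih => exact sum_mem fun x _ => ih _ (L.lie_mem hQ (hL x))

/-- Up to sign, the part of the expansion of `bracketSum` in which `i` letters stand, in reverse
order, on the left of `Q` and `j` letters on its right. -/
noncomputable def sandwich (i j : ℕ) (C : NCSeries R X) (Q : MonoidAlgebra R (FreeMonoid X)) :
    MonoidAlgebra R (FreeMonoid X) :=
  wordSum i fun a => wordSum j fun b => coprod C a b • (word R a.reverse * Q * word R b)

theorem sandwich_sub (i j : ℕ) (C : NCSeries R X) (Q Q' : MonoidAlgebra R (FreeMonoid X)) :
    sandwich i j C (Q - Q') = sandwich i j C Q - sandwich i j C Q' := by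
  rw [eq_sub_iff_add_eq]
  simp only [sandwich]
  rw [← wordSum_add]
  congr 1
  funext a
  rw [← wordSum_add]
  congr 1
  funext b
  rw [← smul_add, ← add_mul, ← mul_add, sub_add_cancel]

theorem sandwich_zero_succ (j : ℕ) (C : NCSeries R X) (Q : MonoidAlgebra R (FreeMonoid X)) :
    sandwich 0 (j + 1) C Q = ∑ x, sandwich 0 j (fun w => C (x :: w)) (Q * word R [x]) := by
  simp [sandwich, wordSum, word_nil, mul_assoc, ← word_append]

theorem sandwich_succ_zero (i : ℕ) (C : NCSeries R X) (Q : MonoidAlgebra R (FreeMonoid X)) :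
    sandwich (i + 1) 0 C Q = ∑ x, sandwich i 0 (fun w => C (x :: w)) (word R [x] * Q) := by
  simp [sandwich, wordSum, word_nil, ← mul_assoc, word_append]

theorem sandwich_succ_succ (i j : ℕ) (C : NCSeries R X) (Q : MonoidAlgebra R (FreeMonoid X)) :
    sandwich (i + 1) (j + 1) C Q =
      ∑ x, sandwich (i + 1) j (fun w => C (x :: w)) (Q * word R [x]) +
      ∑ x, sandwich i (j + 1) (fun w => C (x :: w)) (word R [x] * Q) := by
  have h1 : ∑ x, sandwich i (j + 1) (fun w => C (x :: w)) (word R [x] * Q) =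
      wordSum (i + 1) fun a => wordSum (j + 1) fun b =>
        (match a with | [] => 0 | x :: a => coprod (fun w => C (x :: w)) a b) •
          (word R a.reverse * Q * word R b) := by
    simp [sandwich, wordSum, ← mul_assoc, word_append]
  have h2 : ∑ x, sandwich (i + 1) j (fun w => C (x :: w)) (Q * word R [x]) =
      wordSum (i + 1) fun a => wordSum (j + 1) fun b =>
        (match b with | [] => 0 | x :: b => coprod (fun w => C (x :: w)) a b) •
          (word R a.reverse * Q * word R b) := by
    simp only [sandwich]
    rw [← wordSum_sum]
    simp only [wordSum, mul_assoc, ← word_append, List.singleton_append]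
  rw [h1, h2, ← wordSum_add, sandwich]
  refine wordSum_congr fun a ha => ?_
  rw [← wordSum_add]
  refine wordSum_congr fun b hb => ?_
  cases a with
  | nil => simp at ha
  | cons x a =>
    cases b with
    | nil => simp at hb
    | cons y b => rw [← add_smul, coprod_cons_cons, add_comm]

/-- Expansion of the iterated brackets: each letter of a word goes to the right of `Q`, or to the
left with a sign. The words giving the same result `a.reverse Q b` are those of `a ⧢ b`. -/
theorem bracketSum_eq (k : ℕ) (C : NCSeries R X) (Q : MonoidAlgebra R (FreeMonoid X)) :
    bracketSum k C Q = ∑ ij ∈ antidiagonal k,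
      (-1 : R) ^ ij.1 • sandwich ij.1 ij.2 C Q := by
  induction k generalizing C Q with
  | zero =>
    simp [bracketSum, sandwich, wordSum, word_nil]
  | succ k ih =>
    -- The words of `a ⧢ b` are split according to the factor their first letter comes from.
    let fr : ℕ → ℕ → MonoidAlgebra R (FreeMonoid X) := fun i j => match j with
      | 0 => 0
      | j + 1 => (-1 : R) ^ i • ∑ x, sandwich i j (fun w => C (x :: w)) (Q * word R [x])
    let fl : ℕ → ℕ → MonoidAlgebra R (FreeMonoid X) := fun i j => match i with
      | 0 => 0
      | i + 1 => (-1 : R) ^ (i + 1) • ∑ x, sandwich i j (fun w => C (x :: w)) (word R [x] * Q)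
    have h : ∀ ij ∈ antidiagonal (k + 1),
        (-1 : R) ^ ij.1 • sandwich ij.1 ij.2 C Q = fr ij.1 ij.2 + fl ij.1 ij.2 := by
      rintro ⟨i, j⟩ hij
      rw [mem_antidiagonal] at hij
      cases i with
      | zero =>
        cases j with
        | zero => simp at hij
        | succ j => simp only [fr, fl, sandwich_zero_succ, add_zero]
      | succ i =>
        cases j with
        | zero => simp only [fr, fl, sandwich_succ_zero, zero_add]
        | succ j => simp only [fr, fl, sandwich_succ_succ, smul_add]
    rw [Finset.sum_congr rfl h, Finset.sum_add_distrib, Finset.Nat.sum_antidiagonal_succ',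
      Finset.Nat.sum_antidiagonal_succ]
    simp only [fr, fl, zero_add, bracketSum, ih, LieRing.of_associative_ring_bracket,
      sandwich_sub]
    rw [Finset.sum_comm, ← Finset.sum_add_distrib]
    refine Finset.sum_congr rfl fun ij _ => ?_
    rw [← Finset.smul_sum, Finset.sum_sub_distrib, pow_succ, smul_sub]
    simp [sub_eq_add_neg]

/-- The Dynkin–Specht–Wever identity: on the homogeneous component of degree `k + 1` of a primitive
series, iterated bracketing is multiplication by `k + 1`. By `IsPrimitive.coprod_shift`, each of the
`k + 1` positions of the first letter in the expansion contributes this component once. -/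
theorem IsPrimitive.sum_bracketSum {C : NCSeries R X} (hC : C.IsPrimitive) (k : ℕ) :
    ∑ x, bracketSum k (fun w => C (x :: w)) (word R [x]) =
      (k + 1) • wordSum (k + 1) fun w => C w • word R w := by
  simp only [bracketSum_eq]
  rw [Finset.sum_comm]
  have h : ∀ ij ∈ antidiagonal k,
      ∑ x, (-1 : R) ^ ij.1 • sandwich ij.1 ij.2 (fun w => C (x :: w)) (word R [x]) =
        wordSum (k + 1) fun w => C w • word R w := by
    rintro ⟨i, j⟩ hij
    rw [mem_antidiagonal] at hij
    have e : k + 1 = i + (j + 1) := by simp at hij; omega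
    rw [e, ← wordSum_append, ← wordSum_reverse]
    simp only [wordSum]
    rw [wordSum_sum]
    refine Finset.sum_congr rfl fun x _ => ?_
    rw [sandwich]
    have hsmul := map_wordSum (X := X)
      (DistribSMul.toAddMonoidHom (MonoidAlgebra R (FreeMonoid X)) ((-1 : R) ^ i))
    simp only [DistribSMul.toAddMonoidHom_apply] at hsmul
    rw [hsmul]
    refine wordSum_congr fun a ha => ?_
    rw [hsmul]
    refine wordSum_congr fun b _ => ?_
    have h1 : (-1 : R) ^ i * ((-1 : R) ^ i * C (a.reverse ++ x :: b)) =
        C (a.reverse ++ x :: b) := by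
      rw [← mul_assoc, ← mul_pow]
      simp
    rw [hC.coprod_shift, ha, smul_smul, h1, mul_assoc, ← word_append, ← word_append,
      List.singleton_append]
  rw [Finset.sum_congr rfl h, Finset.sum_const, Finset.Nat.card_antidiagonal]

/-- `∑ ⟨C | w⟩ w` over the words of length `k` is the homogeneous component of degree `k` of `C`. -/
theorem coeff_wordSum (C : NCSeries R X) (k : ℕ) (v : FreeMonoid X) :
    (wordSum k fun w => C w • word R w).coeff v =
      if v.toList.length = k then C v.toList else 0 := by
  classical
  have h := map_wordSum ((Finsupp.applyAddHom v).comp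
    (MonoidAlgebra.coeffAddEquiv (R := R) (M := FreeMonoid X)).toAddMonoidHom) k
    (fun w => C w • word R w)
  refine h.trans ?_
  rw [← wordSum_ite]
  congr 1
  funext w
  have := coeff_word (R := R) w v.toList
  rw [FreeMonoid.ofList_toList] at this
  change (C w • word R w).coeff v = _
  rw [MonoidAlgebra.coeff_smul_apply, this]
  simp

/-- Friedrichs' theorem. -/
theorem IsPrimitive.isLieSeries {K : Type*} [Field K] [CharZero K] {C : NCSeries K X}
    (hC : C.IsPrimitive) : C.IsLieSeries := by
  intro k
  cases k with
  | zero =>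
    refine ⟨0, zero_mem _, fun w => ?_⟩
    split_ifs with h
    · rw [List.length_eq_zero_iff.1 h, hC.1]
      rfl
    · rfl
  | succ k =>
    refine ⟨((k + 1 : ℕ) : K)⁻¹ • ∑ x, bracketSum k (fun w => C (x :: w)) (word K [x]), ?_, ?_⟩
    · have hx (x : X) := LieSubalgebra.subset_lieSpan (R := K)
        (L := MonoidAlgebra K (FreeMonoid X)) (Set.mem_range_self
          (f := fun x : X => MonoidAlgebra.of K (FreeMonoid X) (FreeMonoid.of x)) x)
      exact LieSubalgebra.smul_mem _ _ (sum_mem fun x _ => bracketSum_mem _ hx _ _ (hx x))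
    · intro w
      have hk : ((k + 1 : ℕ) : K) ≠ 0 := by exact_mod_cast k.succ_ne_zero
      rw [hC.sum_bracketSum, ← Nat.cast_smul_eq_nsmul K, smul_smul, inv_mul_cancel₀ hk, one_smul,
        coeff_wordSum]

end Dynkin

end NCSeries

end NCDiff
namespace NCDiff

/-! ### Holomorphic functions on a connected manifold spread over `ℂ^n` -/

section Holomorphic

variable {n : ℕ} {V : Type*} [TopologicalSpace V] {p : V → Fin n → ℂ}

theorem eventually_nhds_map_iff (hp : IsLocalHomeomorph p) {v : V} {P : (Fin n → ℂ) → Prop} :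
    (∀ᶠ w in 𝓝 v, P (p w)) ↔ ∀ᶠ x in 𝓝 (p v), P x := by
  rw [← hp.map_nhds_eq v, eventually_map]

/-- The identity theorem for germs: a holomorphic function vanishing near a point of a connected
manifold vanishes. -/
theorem Holo.eq_zero_of_eventuallyEq_zero [PreconnectedSpace V] (hp : IsLocalHomeomorph p)
    (f : Holo p) {v₀ : V} (h : (f : V → ℂ) =ᶠ[𝓝 v₀] 0) : f = 0 := by
  have hclopen : IsClopen {v : V | (f : V → ℂ) =ᶠ[𝓝 v] 0} := by
    refine ⟨isClosed_of_closure_subset fun v hv => ?_, isOpen_setOfPred_eventually_nhds⟩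
    obtain ⟨g, hg, hfg⟩ := f.2 v
    obtain ⟨r, hr, hball⟩ := Metric.eventually_nhds_iff_ball.1 hg.eventually_analyticAt
    have hN : ∀ᶠ w in 𝓝 v, (f : V → ℂ) =ᶠ[𝓝 w] g ∘ p ∧ p w ∈ Metric.ball (p v) r :=
      hfg.eventuallyEq_nhds.and ((eventually_nhds_map_iff hp).2 (Metric.ball_mem_nhds _ hr))
    obtain ⟨w, ⟨hw, hwr⟩, hw0⟩ := mem_closure_iff_nhds.1 hv _ hN
    have h0 : g =ᶠ[𝓝 (p w)] 0 := (eventually_nhds_map_iff hp).1 (hw.symm.trans hw0)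
    have h1 : Set.EqOn g 0 (Metric.ball (p v) r) :=
      AnalyticOnNhd.eqOn_zero_of_preconnected_of_eventuallyEq_zero (fun x hx => hball x hx)
        (convex_ball _ _).isPreconnected hwr h0
    refine hfg.trans ((eventually_nhds_map_iff hp (P := fun x => g x = 0)).2 ?_)
    filter_upwards [Metric.ball_mem_nhds (p v) hr] with x hx using h1 hx
  have huniv := hclopen.eq_univ ⟨v₀, h⟩
  ext v
  have hv : v ∈ {v : V | (f : V → ℂ) =ᶠ[𝓝 v] 0} := huniv ▸ Set.mem_univ v
  exact hv.eq_of_nhds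

theorem Holo.eventually_ne_zero (hp : IsLocalHomeomorph p) {f : Holo p} {v : V}
    (h : (f : V → ℂ) v ≠ 0) : ∀ᶠ w in 𝓝 v, (f : V → ℂ) w ≠ 0 := by
  obtain ⟨g, hg, hfg⟩ := f.2 v
  have hc : ContinuousAt (f : V → ℂ) v :=
    (hg.continuousAt.comp hp.continuous.continuousAt).congr hfg.symm
  exact hc.eventually_ne h

theorem Holo.exists_ne_zero {f : Holo p} (hf : f ≠ 0) : ∃ v, (f : V → ℂ) v ≠ 0 := by
  by_contra! h
  exact hf (Subtype.ext (funext h))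

/-- By continuity, a function that is not zero is nonzero on a nonempty open set, where the other
factor of a vanishing product is zero. -/
theorem Holo.isDomain [ConnectedSpace V] (hp : IsLocalHomeomorph p) : IsDomain (Holo p) := by
  have : Nontrivial (Holo p) := by
    obtain ⟨v⟩ := (inferInstance : Nonempty V)
    refine ⟨0, 1, fun h => ?_⟩
    exact zero_ne_one (congrFun (congrArg Subtype.val h) v)
  have : NoZeroDivisors (Holo p) := by
    refine ⟨fun {a b} hab => ?_⟩
    by_contra! h
    obtain ⟨v, hv⟩ := Holo.exists_ne_zero h.1
    refine h.2 (Holo.eq_zero_of_eventuallyEq_zero hp b (v₀ := v) ?_)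
    filter_upwards [Holo.eventually_ne_zero hp hv] with w hw
    have := congrFun (congrArg Subtype.val hab) w
    exact (mul_eq_zero.1 this).resolve_left hw
  exact NoZeroDivisors.to_isDomain _

/-- Two holomorphic functions on a connected manifold whose quotient has zero derivative are
proportional: the quotient is a constant `c` near a point where `b` does not vanish, and `a - c b`
vanishes near that point. -/
theorem Holo.exists_smul_eq [PreconnectedSpace V] (hp : IsLocalHomeomorph p) {a b : Holo p}
    (hb : b ≠ 0) (h : ∀ i, b * pd hp i a = a * pd hp i b) : ∃ c : ℂ, a = c • b := by
  obtain ⟨v, hv⟩ := Holo.exists_ne_zero hb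
  obtain ⟨g, hg, hag⟩ := a.2 v
  obtain ⟨k, hk, hbk⟩ := b.2 v
  have hpd : ∀ᶠ x in 𝓝 (p v), ∀ i, k x * fderiv ℂ g x (Pi.single i 1) =
      g x * fderiv ℂ k x (Pi.single i 1) := by
    rw [← eventually_nhds_map_iff hp]
    filter_upwards [hag.eventuallyEq_nhds, hbk.eventuallyEq_nhds] with w hw hw' i
    rw [← pdFun_eq hp i a w g hw, ← pdFun_eq hp i b w k hw']
    have e1 : (a : V → ℂ) w = g (p w) := hw.eq_of_nhds
    have e2 : (b : V → ℂ) w = k (p w) := hw'.eq_of_nhds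
    rw [← e1, ← e2]
    exact congrFun (congrArg Subtype.val (h i)) w
  have hk0 : k (p v) ≠ 0 := by
    have e : (b : V → ℂ) v = k (p v) := hbk.eq_of_nhds
    rwa [← e]
  obtain ⟨r, hr, hball⟩ := Metric.eventually_nhds_iff_ball.1
    (hpd.and ((hk.continuousAt.eventually_ne hk0).and
      (hg.eventually_analyticAt.and hk.eventually_analyticAt)))
  have hder : ∀ x ∈ Metric.ball (p v) r, HasFDerivAt (fun x => g x * (k x)⁻¹)
      (0 : (Fin n → ℂ) →L[ℂ] ℂ) x := by
    intro x hx
    obtain ⟨hx1, hx2, hx3, hx4⟩ := hball x hx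
    have hinv := (hasDerivAt_inv hx2).comp_hasFDerivAt x hx4.differentiableAt.hasFDerivAt
    have hmul := hx3.differentiableAt.hasFDerivAt.mul hinv
    refine hmul.congr_fderiv (ContinuousLinearMap.coe_injective (LinearMap.pi_ext' fun i => ?_))
    ext
    have := hx1 i
    simp only [Function.comp_apply, ContinuousLinearMap.toLinearMap_add,
      ContinuousLinearMap.toLinearMap_smul,
      LinearMap.comp_apply, LinearMap.add_apply, LinearMap.smul_apply, LinearMap.single_apply,
      ContinuousLinearMap.coe_coe, smul_eq_mul, ContinuousLinearMap.toLinearMap_zero,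
      LinearMap.zero_apply]
    field_simp
    linear_combination this
  have hconst : ∀ x ∈ Metric.ball (p v) r, g x * (k x)⁻¹ = g (p v) * (k (p v))⁻¹ := by
    intro x hx
    exact Metric.isOpen_ball.is_const_of_fderiv_eq_zero (convex_ball _ _).isPreconnected
      (fun y hy => (hder y hy).differentiableAt.differentiableWithinAt)
      (fun y hy => (hder y hy).fderiv) hx (Metric.mem_ball_self hr)
  refine ⟨g (p v) * (k (p v))⁻¹,
    sub_eq_zero.1 (Holo.eq_zero_of_eventuallyEq_zero hp _ (v₀ := v) ?_)⟩
  filter_upwards [hag, hbk, (eventually_nhds_map_iff hp).2 (Metric.ball_mem_nhds (p v) hr)]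
    with w hw hw' hwr
  change (a : V → ℂ) w - g (p v) * (k (p v))⁻¹ * (b : V → ℂ) w = 0
  have := (hball _ hwr).2.1
  rw [hw, hw', ← hconst _ hwr, Function.comp_apply, Function.comp_apply,
    inv_mul_cancel_right₀ this, sub_self]

theorem Holo.exists_eq_algebraMap [ConnectedSpace V] (hp : IsLocalHomeomorph p) {a : Holo p}
    (h : ∀ i, pd hp i a = 0) : ∃ c : ℂ, a = algebraMap ℂ (Holo p) c := by
  have := Holo.isDomain hp
  obtain ⟨c, hc⟩ := Holo.exists_smul_eq hp (a := a) one_ne_zero (by simp [h])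
  exact ⟨c, by rw [hc, Algebra.smul_def, mul_one]⟩

/-- The constants of the fraction field of the holomorphic functions are the complex numbers. -/
theorem exists_eq_algebraMap_of_fracD_eq_zero [ConnectedSpace V] (hp : IsLocalHomeomorph p)
    {f : FractionRing (Holo p)} (h : fracD hp f = 0) : ∃ c : ℂ, f = algebraMap ℂ _ c := by
  have := Holo.isDomain hp
  obtain ⟨a, b, hb, rfl⟩ := IsFractionRing.div_surjective (A := Holo p) f
  have hb0 : algebraMap (Holo p) (FractionRing (Holo p)) b ≠ 0 :=
    IsFractionRing.to_map_ne_zero_of_mem_nonZeroDivisors hb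
  have key (i : Fin n) : b * pd hp i a = a * pd hp i b := by
    apply IsFractionRing.injective (Holo p) (FractionRing (Holo p))
    rw [map_mul, map_mul, ← fracDer_algebraMap, ← fracDer_algebraMap]
    have h1 := fracDer_mul (pd hp i)
      (algebraMap (Holo p) (FractionRing (Holo p)) a / algebraMap (Holo p) _ b)
      (algebraMap (Holo p) _ b)
    have h2 : fracDer (pd hp i) (algebraMap (Holo p) (FractionRing (Holo p)) a /
      algebraMap (Holo p) _ b) = 0 := congrFun h i
    rw [h2, div_mul_cancel₀ _ hb0] at h1
    rw [h1]
    field_simp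
    ring
  obtain ⟨c, rfl⟩ := Holo.exists_smul_eq hp (nonZeroDivisors.ne_zero hb) key
  refine ⟨c, ?_⟩
  rw [Algebra.smul_def, map_mul, mul_div_cancel_right₀ _ hb0, ← IsScalarTower.algebraMap_apply]

end Holomorphic

/-! ### The field of fractions of a differential subring -/

section Fractions

variable {A : Type*} [CommRing A] [IsDomain A] [Algebra ℂ A]

/-- The fraction field of a subring `C` of `A`, as a subfield of the fractions of `A`. -/
noncomputable def fracSubfield (C : Subalgebra ℂ A) : Subfield (FractionRing A) where
  carrier := fracOf C
  mul_mem' := by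
    rintro f g ⟨a, ha, b, hb, hb0, h⟩ ⟨a', ha', b', hb', hb0', h'⟩
    refine ⟨a * a', C.mul_mem ha ha', b * b', C.mul_mem hb hb', mul_ne_zero hb0 hb0', ?_⟩
    rw [map_mul, map_mul, ← h, ← h']
    ring
  one_mem' := ⟨1, C.one_mem, 1, C.one_mem, one_ne_zero, by simp⟩
  add_mem' := by
    rintro f g ⟨a, ha, b, hb, hb0, h⟩ ⟨a', ha', b', hb', hb0', h'⟩
    refine ⟨a * b' + a' * b, C.add_mem (C.mul_mem ha hb') (C.mul_mem ha' hb), b * b',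
      C.mul_mem hb hb', mul_ne_zero hb0 hb0', ?_⟩
    rw [map_mul, map_add, map_mul, map_mul, ← h, ← h']
    ring
  zero_mem' := ⟨0, C.zero_mem, 1, C.one_mem, one_ne_zero, by simp⟩
  neg_mem' := by
    rintro f ⟨a, ha, b, hb, hb0, h⟩
    exact ⟨-a, C.neg_mem ha, b, hb, hb0, by rw [map_neg, ← h]; ring⟩
  inv_mem' := by
    rintro f ⟨a, ha, b, hb, hb0, h⟩
    by_cases hf : f = 0
    · exact ⟨0, C.zero_mem, 1, C.one_mem, one_ne_zero, by simp [hf]⟩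
    · refine ⟨b, hb, a, ha, ?_, ?_⟩
      · rintro rfl
        rw [map_zero, mul_eq_zero, FaithfulSMul.algebraMap_eq_zero_iff] at h
        exact h.elim hf hb0
      · rw [← h, inv_mul_cancel_left₀ hf]

theorem algebraMap_mem_fracOf {C : Subalgebra ℂ A} {a : A} (ha : a ∈ C) :
    algebraMap A (FractionRing A) a ∈ fracOf C :=
  ⟨a, ha, 1, C.one_mem, one_ne_zero, by simp⟩

theorem fracDer_mem_fracOf {C : Subalgebra ℂ A} {D : Derivation ℂ A A} (hD : ∀ a ∈ C, D a ∈ C)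
    {f : FractionRing A} (hf : f ∈ fracOf C) : fracDer D f ∈ fracOf C := by
  obtain ⟨a, ha, b, hb, hb0, h⟩ := hf
  refine ⟨b * D a - a * D b, C.sub_mem (C.mul_mem hb (hD a ha)) (C.mul_mem ha (hD b hb)), b * b,
    C.mul_mem hb hb, mul_ne_zero hb0 hb0, ?_⟩
  have h1 := congrArg (fracDer D) h
  rw [fracDer_mul, fracDer_algebraMap, fracDer_algebraMap] at h1
  rw [map_sub, map_mul, map_mul, map_mul, ← h, ← h1]
  ring

end Fractions

end NCDiff
namespace NCDiff

/-! ### Linear independence of the coefficients of a solution -/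

section Criterion

open NCSeries

variable {L ι X : Type*} [Field L] [Fintype X] {D : ι → L →+ L}
  {ω : X → ι → L} {S : List X → L} {K : Subfield L}

/-- The derivative of a linear combination `∑ p_w S_w` of the coefficients of a solution is the
linear combination with coefficients `D p_w + ∑ p_{xw} ω_x`. -/
theorem map_sum_wordSum_mul (hD : ∀ k a b, D k (a * b) = a * D k b + b * D k a)
    (hS0 : ∀ k, D k (S []) = 0) (hS : ∀ k x w, D k (S (x :: w)) = ω x k * S w) (k : ι)
    {m : ℕ} {q : List X → L} (hq : ∀ w, m < w.length → q w = 0) :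
    D k (∑ j ∈ Finset.range (m + 1), wordSum j fun w => q w * S w) =
      ∑ j ∈ Finset.range (m + 1), wordSum j fun w =>
        (D k (q w) + ∑ x, q (x :: w) * ω x k) * S w := by
  have h1 : ∀ j, D k (wordSum j fun w => q w * S w) =
      (wordSum j fun w => D k (q w) * S w) + wordSum j fun w => q w * D k (S w) := by
    intro j
    rw [map_wordSum, ← wordSum_add]
    congr 1
    funext w
    rw [hD]
    ring
  have h2 : ∀ j, (wordSum (j + 1) fun w => q w * D k (S w)) =
      wordSum j fun w => (∑ x, q (x :: w) * ω x k) * S w := by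
    intro j
    simp only [Finset.sum_mul]
    rw [wordSum_sum]
    simp only [wordSum, hS, mul_assoc]
  have h3 : (wordSum m fun w => (∑ x, q (x :: w) * ω x k) * S w) = 0 := by
    rw [← wordSum_zero (X := X) (M := L) m]
    refine wordSum_congr fun w hw => ?_
    rw [Finset.sum_eq_zero, zero_mul]
    intro x _
    rw [hq _ (by simp [hw]), zero_mul]
  rw [map_sum]
  simp only [h1, add_mul, wordSum_add, Finset.sum_add_distrib]
  congr 1
  rw [Finset.sum_range_succ', Finset.sum_range_succ _ m, h3]
  simp only [h2]
  simp [wordSum, hS0]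

/-- A sum over a finite set of words, graded by the length. -/
theorem sum_wordSum_ite [DecidableEq X] (s : Finset (List X)) (f : List X → L) :
    ∑ j ∈ Finset.range (s.sup List.length + 1), (wordSum j fun w => if w ∈ s then f w else 0) =
      ∑ w ∈ s, f w := by
  have h : ∀ j, (wordSum j fun w => if w ∈ s then f w else 0) =
      ∑ v ∈ s, if v.length = j then f v else 0 := by
    intro j
    simp only [← wordSum_ite j _ f]
    rw [← wordSum_sum]
    congr 1
    funext w
    rw [Finset.sum_ite_eq]
  simp only [h]
  rw [Finset.sum_comm]
  refine Finset.sum_congr rfl fun v hv => ?_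
  rw [Finset.sum_ite_eq, if_pos]
  exact Finset.mem_range_succ_iff.2 (Finset.le_sup (f := List.length) hv)

variable [Algebra ℂ L]

/-- If no nontrivial constant combination of the forms `ω_x` has a primitive in `K`, a linear
relation over `K` among the `S_w` is trivial. A nontrivial relation of least degree, with the least
number of terms of that degree and one of their coefficients equal to `1`, would have a trivial
derivative; its coefficients of highest degree would then be constants, and its coefficients of the
next degree primitives of combinations of the `ω_x`. -/
theorem eq_zero_of_sum_wordSum_mul_eq_zero
    (hD : ∀ k a b, D k (a * b) = a * D k b + b * D k a) (hKD : ∀ k, ∀ a ∈ K, D k a ∈ K)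
    (hconst : ∀ a, (∀ k, D k a = 0) → ∃ c : ℂ, a = algebraMap ℂ L c)
    (hωK : ∀ x k, ω x k ∈ K) (hS1 : S [] = 1)
    (hS : ∀ k x w, D k (S (x :: w)) = ω x k * S w)
    (hE : ∀ c : X → ℂ, ∀ f ∈ K, (∀ k, ∑ x, algebraMap ℂ L (c x) * ω x k = D k f) → ∀ x, c x = 0)
    (m : ℕ) : ∀ q : List X → L, (∀ w, q w ∈ K) → (∀ w, m < w.length → q w = 0) →
      ∑ j ∈ Finset.range (m + 1), (wordSum j fun w => q w * S w) = 0 → ∀ w, q w = 0 := by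
  have hD1 : ∀ k, D k 1 = 0 := fun k => by simpa using hD k 1 1
  have hS0 : ∀ k, D k (S []) = 0 := fun k => by rw [hS1, hD1]
  induction m with
  | zero =>
    intro q _ hq h w
    cases w with
    | nil => simpa [wordSum, hS1] using h
    | cons x w => exact hq _ (by simp)
  | succ m ihm =>
    -- Inner induction, on the number `N` of nonzero coefficients of degree `m + 1`.
    suffices H : ∀ N : ℕ, ∀ q : List X → L, (∀ w, q w ∈ K) → (∀ w, m + 1 < w.length → q w = 0) →
        {w : List X | w.length = m + 1 ∧ q w ≠ 0}.ncard = N →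
        ∑ j ∈ Finset.range (m + 1 + 1), (wordSum j fun w => q w * S w) = 0 → ∀ w, q w = 0 from
      fun q hK hq h => H _ q hK hq rfl h
    intro N
    induction N using Nat.strong_induction_on with
    | _ N ihN =>
    intro q hK hq hN h
    have hfin (q : List X → L) : {w : List X | w.length = m + 1 ∧ q w ≠ 0}.Finite :=
      (List.finite_length_eq X (m + 1)).subset fun w hw => hw.1
    by_cases htop : ∀ w, w.length = m + 1 → q w = 0
    · refine ihm q hK (fun w hw => ?_) ?_
      · rcases Nat.lt_or_eq_of_le (Nat.succ_le_of_lt hw) with h' | h'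
        · exact hq w h'
        · exact htop w h'.symm
      · rw [Finset.sum_range_succ, wordSum_congr (g := fun _ => 0), wordSum_zero, add_zero] at h
        · exact h
        · intro w hw
          rw [htop w hw, zero_mul]
    · exfalso
      push Not at htop
      obtain ⟨w₀, hw₀, hne⟩ := htop
      -- Dividing by the coefficient of `w₀` makes it `1`, which disappears on differentiation.
      have hq'K : ∀ w, (q w₀)⁻¹ * q w ∈ K := fun w => K.mul_mem (K.inv_mem (hK w₀)) (hK w)
      have hq' : ∀ w, m + 1 < w.length → (q w₀)⁻¹ * q w = 0 := fun w hw => by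
        rw [hq w hw, mul_zero]
      have h' : ∑ j ∈ Finset.range (m + 1 + 1), (wordSum j fun w => (q w₀)⁻¹ * q w * S w) = 0 := by
        have e : ∀ j, (wordSum j fun w => (q w₀)⁻¹ * q w * S w) =
            (q w₀)⁻¹ * wordSum j fun w => q w * S w := by
          intro j
          have := map_wordSum (AddMonoidHom.mulLeft (q w₀)⁻¹) j fun w => q w * S w
          simp only [AddMonoidHom.coe_mulLeft, ← mul_assoc] at this
          exact this.symm
        simp only [e, ← Finset.mul_sum, h, mul_zero]
      have hder : ∀ k w, D k ((q w₀)⁻¹ * q w) + ∑ x, (q w₀)⁻¹ * q (x :: w) * ω x k = 0 := by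
        intro k
        have hlong : ∀ w : List X, m + 1 ≤ w.length →
            ∑ x, (q w₀)⁻¹ * q (x :: w) * ω x k = 0 := by
          intro w hw
          refine Finset.sum_eq_zero fun x _ => ?_
          rw [hq' _ (by simp only [List.length_cons]; omega), zero_mul]
        refine ihN _ ?_ _ (fun w => ?_) (fun w hw => ?_) rfl ?_
        · rw [← hN]
          refine Set.ncard_lt_ncard ((Set.ssubset_iff_of_subset ?_).2 ⟨w₀, ⟨hw₀, hne⟩, ?_⟩)
            (hfin q)
          · rintro w ⟨hw, hw'⟩
            refine ⟨hw, fun h0 => hw' ?_⟩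
            rw [h0, mul_zero, map_zero, zero_add, hlong w hw.ge]
          · rintro ⟨-, hw'⟩
            refine hw' ?_
            rw [inv_mul_cancel₀ hne, hD1, zero_add, hlong w₀ hw₀.ge]
        · exact K.add_mem (hKD k _ (hq'K w))
            (sum_mem fun x _ => K.mul_mem (hq'K _) (hωK x k))
        · rw [hq' w hw, map_zero, zero_add, hlong w hw.le]
        · rw [← map_sum_wordSum_mul hD hS0 hS k hq', h', map_zero]
      have hc : ∀ w, w.length = m + 1 → ∃ c : ℂ, (q w₀)⁻¹ * q w = algebraMap ℂ L c := by
        intro w hw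
        refine hconst _ fun k => ?_
        have := hder k w
        rwa [Finset.sum_eq_zero, add_zero] at this
        intro x _
        rw [hq' _ (by simp only [List.length_cons]; omega), zero_mul]
      -- The derived relation at `w₁`, where `w₀ = x₀ w₁`, exhibits a primitive of `∑ c_x ω_x`, and
      -- `c_{x₀} = 1`.
      cases w₀ with
      | nil => simp at hw₀
      | cons x₀ w₁ =>
        have hw₁ : ∀ x, (x :: w₁).length = m + 1 := fun x => by simpa using hw₀
        choose c hc using fun x => hc (x :: w₁) (hw₁ x)
        have h0 := hE c (-((q (x₀ :: w₁))⁻¹ * q w₁)) (K.neg_mem (hq'K w₁)) (fun k => by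
          rw [map_neg, eq_neg_iff_add_eq_zero, add_comm, ← hder k w₁]
          simp only [hc]) x₀
        have h1 := hc x₀
        rw [h0, map_zero, inv_mul_cancel₀ hne] at h1
        exact one_ne_zero h1

end Criterion

/-! ### Solutions and their constant right factors -/

section Solutions

open NCSeries

variable {n : ℕ} {V : Type*} [TopologicalSpace V] {p : V → Fin n → ℂ}

/-- The equation `dS = M_n S`, one coordinate at a time, as an equation between scalar series. -/
theorem isSolution_iff (hp : IsLocalHomeomorph p) (ω : Letter n → Fin n → Holo p)
    (S : NCSeries (Holo p) (Letter n)) :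
    IsSolution hp ω S ↔ ∀ k, (fun w => pd hp k (S w)) =
      conc (fun w => connection ω w k : NCSeries (Holo p) (Letter n)) S := by
  have h : ∀ w k, conc (connection ω) S w k =
      conc (fun w => connection ω w k : NCSeries (Holo p) (Letter n)) S w := by
    intro w k
    simp [conc, Finset.sum_apply]
  constructor
  · intro hS k
    funext w
    rw [← h, ← hS]
    rfl
  · intro hS
    funext w k
    rw [h, ← hS]
    rfl

theorem IsSolution.pd_cons {hp : IsLocalHomeomorph p} {ω : Letter n → Fin n → Holo p}
    {S : NCSeries (Holo p) (Letter n)} (hS : IsSolution hp ω S) (k : Fin n) (x : Letter n)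
    (w : List (Letter n)) : pd hp k (S (x :: w)) = ω x k * S w := by
  have h := congrFun ((isSolution_iff hp ω S).1 hS k) (x :: w)
  refine h.trans ?_
  rw [conc_cons]
  have h1 : (fun u => connection ω (x :: u) k) = fun u => ω x k • (one u : Holo p) := by
    funext u
    cases u with
    | nil => simp [connection, one]
    | cons => simp [connection, one]
  have h2 := congrFun (conc_smul_left (ω x k) one S) w
  rw [one_conc] at h2
  rw [h1]
  refine (congrArg _ h2).trans ?_
  simp [connection]

theorem derivation_conc {A X : Type*} [CommRing A] [Algebra ℂ A] (D : Derivation ℂ A A)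
    (P Q : NCSeries A X) : (fun w => D (conc P Q w)) =
      conc (fun w => D (P w)) Q + conc P (fun w => D (Q w)) := by
  funext w
  simp only [conc, map_sum, Pi.add_apply, ← Finset.sum_add_distrib, smul_eq_mul,
    Derivation.leibniz]
  exact Finset.sum_congr rfl fun i _ => by ring

theorem conc_ofConst {A X : Type*} [CommRing A] [Algebra ℂ A] (P Q : NCSeries ℂ X) :
    conc (ofConst A P) (ofConst A Q) = ofConst A (conc P Q) := by
  funext w
  simp [conc, ofConst]

theorem one_ofConst {A X : Type*} [CommRing A] [Algebra ℂ A] :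
    ofConst A (one : NCSeries ℂ X) = one := by
  funext w
  cases w <;> simp [ofConst, one]

theorem exp_ofConst {A X : Type*} [CommRing A] [Algebra ℂ A] (C : NCSeries ℂ X) :
    exp (ofConst A C) = ofConst A (exp C) := by
  have hpow (k : ℕ) : pow (ofConst A C) k = ofConst A (pow C k) := by
    induction k with
    | zero => exact one_ofConst.symm
    | succ k ih => rw [pow, ih, conc_ofConst, pow]
  funext w
  simp [exp, hpow, ofConst, Algebra.smul_def]

theorem isGrouplike_ofConst_iff {A X : Type*} [CommRing A] [Nontrivial A] [Algebra ℂ A]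
    {P : NCSeries ℂ X} : (ofConst A P).IsGrouplike ↔ P.IsGrouplike := by
  have h (u v : List X) : coprod (ofConst A P) u v = algebraMap ℂ A (coprod P u v) :=
    coprod_map (algebraMap ℂ A).toAddMonoidHom P u v
  rw [isGrouplike_iff, isGrouplike_iff]
  simp only [h, ofConst, ← map_mul, (algebraMap ℂ A).injective.eq_iff, map_eq_one_iff _
    (algebraMap ℂ A).injective]

theorem IsSolution.conc_ofConst {hp : IsLocalHomeomorph p} {ω : Letter n → Fin n → Holo p}
    {S : NCSeries (Holo p) (Letter n)} (hS : IsSolution hp ω S) (P : NCSeries ℂ (Letter n)) :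
    IsSolution hp ω (conc S (ofConst (Holo p) P)) := by
  rw [isSolution_iff] at hS ⊢
  intro k
  have h0 : (fun w => pd hp k (ofConst (Holo p) P w)) = 0 := by
    funext w
    exact (pd hp k).map_algebraMap _
  rw [derivation_conc, h0, conc_zero, add_zero, hS k, conc_assoc]

/-- Two solutions of which the first is invertible differ by a constant right factor. -/
theorem IsSolution.exists_conc_ofConst [ConnectedSpace V] {hp : IsLocalHomeomorph p}
    {ω : Letter n → Fin n → Holo p} {H H' S : NCSeries (Holo p) (Letter n)}
    (hH : IsSolution hp ω H) (hS : IsSolution hp ω S) (h1 : conc H H' = one)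
    (h2 : conc H' H = one) : ∃ P : NCSeries ℂ (Letter n), ofConst (Holo p) P = conc H' S := by
  rw [isSolution_iff] at hH hS
  set G := conc H' S with hG
  have hHG : conc H G = S := by rw [hG, ← conc_assoc, h1, one_conc]
  have hDG (k : Fin n) : (fun w => pd hp k (G w)) = 0 := by
    have h := derivation_conc (pd hp k) H G
    rw [hHG, hH k, hS k, conc_assoc, hHG] at h
    have h3 : conc H (fun w => pd hp k (G w)) = 0 := left_eq_add.1 h
    rw [← one_conc (fun w => pd hp k (G w)), ← h2, conc_assoc, h3, conc_zero]
  choose P hP using fun w => Holo.exists_eq_algebraMap hp fun k => congrFun (hDG k) w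
  exact ⟨P, funext fun w => (hP w).symm⟩

/-- The grouplike solutions are the right multiples of one of them by the exponentials of constant
Lie series. -/
theorem isGrouplike_isSolution_iff [ConnectedSpace V] {hp : IsLocalHomeomorph p}
    {ω : Letter n → Fin n → Holo p} {S : NCSeries (Holo p) (Letter n)} (hSgl : S.IsGrouplike)
    (hS : IsSolution hp ω S) (H : NCSeries (Holo p) (Letter n)) :
    (H.IsGrouplike ∧ IsSolution hp ω H) ↔
      ∃ C : NCSeries ℂ (Letter n), C.IsLieSeries ∧ S = H.conc (exp (C.ofConst (Holo p))) := by
  have := Holo.isDomain hp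
  have : CharZero (Holo p) := charZero_of_injective_algebraMap (algebraMap ℂ (Holo p)).injective
  constructor
  · rintro ⟨hHgl, hH⟩
    obtain ⟨H', hH'gl, h1, h2⟩ := hHgl.exists_inverse
    obtain ⟨P, hP⟩ := hH.exists_conc_ofConst hS h1 h2
    have hPgl : P.IsGrouplike := by
      rw [← isGrouplike_ofConst_iff (A := Holo p), hP]
      exact isGrouplike_conc hH'gl hSgl
    refine ⟨log P, hPgl.log_isPrimitive.isLieSeries, ?_⟩
    rw [exp_ofConst, hPgl.exp_log, hP, ← conc_assoc, h1, one_conc]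
  · rintro ⟨C, hC, hSH⟩
    obtain ⟨E, hEgl, h1, -⟩ := hC.isPrimitive.exp_isGrouplike.exists_inverse
    have hHS : H = conc S (ofConst (Holo p) E) := by
      rw [hSH, exp_ofConst, conc_assoc, NCDiff.conc_ofConst, h1, one_ofConst, conc_one]
    rw [hHS]
    exact ⟨isGrouplike_conc hSgl (isGrouplike_ofConst_iff.2 hEgl), hS.conc_ofConst E⟩

end Solutions

/-! ### The independence criteria -/

section Independence

open NCSeries

/-- The order of the alphabet as a linear order: its `<` is `Letter.lt`. -/
noncomputable abbrev letterLinearOrder (n : ℕ) : LinearOrder (Letter n) :=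
  haveI : IsStrictTotalOrder (Letter n) Letter.lt :=
    { irrefl := fun a h => by
        unfold Letter.lt at h
        omega
      trans := fun a b c h h' => by
        unfold Letter.lt at *
        omega
      trichotomous := fun a b h h' => by
        unfold Letter.lt at *
        apply Subtype.ext
        apply Prod.ext <;> apply Fin.ext <;> omega }
  haveI : DecidableRel (Letter.lt (n := n)) := Classical.decRel _
  linearOrderOfSTO Letter.lt

variable {n : ℕ} {V : Type*} [TopologicalSpace V] {p : V → Fin n → ℂ}

theorem algebraicIndependent_of_linearIndependent [ConnectedSpace V] (hp : IsLocalHomeomorph p)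
    (𝒞 : Subalgebra ℂ (Holo p)) {S : NCSeries (Holo p) (Letter n)} (hSgl : S.IsGrouplike)
    (h : LinearIndependent 𝒞 (fun w : List (Letter n) => S w)) :
    AlgebraicIndependent 𝒞 (fun l : {l : List (Letter n) // IsLyndon Letter.lt l} => S l.1) := by
  have := Holo.isDomain hp
  have : CharZero 𝒞 := charZero_of_injective_algebraMap (algebraMap ℂ 𝒞).injective
  exact @algebraicIndependent_lyndon _ 𝒞 (Holo p) _ _ _ (letterLinearOrder n) _ _ S hSgl h

theorem isLyndon_singleton {X : Type*} (r : X → X → Prop) (x : X) : IsLyndon r [x] := by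
  refine ⟨by simp, fun u v hu hv h => ?_⟩
  have := congrArg List.length h
  have := List.length_pos_iff.2 hu
  have := List.length_pos_iff.2 hv
  simp at *
  omega

/-- Algebraically independent elements, together with `1`, are linearly independent. -/
theorem linearIndependent_option_of_algebraicIndependent {R A ι : Type*} [CommRing R] [CommRing A]
    [Algebra R A] {x : ι → A} (h : AlgebraicIndependent R x) :
    LinearIndependent R (fun i : Option ι => i.elim 1 x) := by
  have h1 := (MvPolynomial.basisMonomials ι R).linearIndependent
  have h2 : Function.Injective fun i : Option ι => i.elim 0 fun i => Finsupp.single i 1 := by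
    rintro (_ | i) (_ | j) hij
    · rfl
    · exact absurd hij.symm (by simp)
    · exact absurd hij (by simp)
    · simpa using (Finsupp.single_left_injective one_ne_zero hij)
  have h3 := (h1.comp _ h2).map' (MvPolynomial.aeval x).toLinearMap
    (LinearMap.ker_eq_bot.2 h)
  have e : (fun i : Option ι => i.elim 1 x) = (MvPolynomial.aeval x).toLinearMap ∘
      MvPolynomial.basisMonomials ι R ∘
        fun i : Option ι => i.elim 0 fun i => Finsupp.single i 1 := by
    funext i
    cases i with
    | none => simp
    | some i => simp [MvPolynomial.aeval_monomial]
  rw [e]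
  exact h3

/-- Linear independence over a subalgebra, in terms of coefficients in the ambient ring. -/
theorem linearIndependent_subalgebra_iff {A ι : Type*} [CommRing A] [Algebra ℂ A]
    (C : Subalgebra ℂ A) (x : ι → A) : LinearIndependent C x ↔ ∀ (s : Finset ι) (g : ι → A),
      (∀ i, g i ∈ C) → ∑ i ∈ s, g i * x i = 0 → ∀ i ∈ s, g i = 0 := by
  refine linearIndependent_iff'.trans ⟨fun h s g hg h0 i hi => ?_, fun h s g h0 i hi => ?_⟩
  · exact congrArg Subtype.val (h s (fun i => ⟨g i, hg i⟩) h0 i hi)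
  · exact Subtype.ext (h s (fun i => g i) (fun i => (g i).2) h0 i hi)

theorem fracForm_apply (ω : Letter n → Fin n → Holo p) (c : Letter n → ℂ) (k : Fin n) :
    (∑ t, c t • toFracForm (ω t)) k = ∑ t, algebraMap ℂ (FractionRing (Holo p)) (c t) *
      algebraMap (Holo p) _ (ω t k) := by
  simp [toFracForm, Finset.sum_apply, Algebra.smul_def]

theorem fracForm_apply' (ω : Letter n → Fin n → Holo p) (c : Letter n → ℂ) (k : Fin n) :
    (∑ t, c t • toFracForm (ω t)) k =
      algebraMap (Holo p) (FractionRing (Holo p)) ((∑ t, c t • ω t) k) := by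
  rw [fracForm_apply, Finset.sum_apply, map_sum]
  refine Finset.sum_congr rfl fun t _ => ?_
  rw [Pi.smul_apply, Algebra.smul_def, map_mul, ← IsScalarTower.algebraMap_apply]

theorem fracD_zero (hp : IsLocalHomeomorph p) : fracD hp (0 : FractionRing (Holo p)) = 0 := by
  funext k
  have := fracDer_add (pd hp k) 0 0
  rw [add_zero] at this
  exact left_eq_add.1 this

/-- The equality `∑ c_t s_t - a / b = κ`, cleared of its denominator. -/
theorem sum_smul_mul_eq_add_smul {A T : Type*} [CommRing A] [IsDomain A] [Algebra ℂ A] [Fintype T]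
    {c : T → ℂ} {s : T → A} {a b : A} {f : FractionRing A} {κ : ℂ}
    (hfab : f * algebraMap A (FractionRing A) b = algebraMap A (FractionRing A) a)
    (hκ : algebraMap A (FractionRing A) (∑ t, c t • s t) - f = algebraMap ℂ (FractionRing A) κ) :
    ∑ t, c t • (b * s t) = a + κ • b := by
  apply IsFractionRing.injective A (FractionRing A)
  simp only [← mul_smul_comm, ← Finset.mul_sum]
  rw [map_mul, map_add, Algebra.smul_def κ, map_mul,
    ← IsScalarTower.algebraMap_apply, ← hκ, ← hfab]
  ring

/-- If some constant combination of the forms `ω_t` is the differential of a fraction `a / b`, then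
`b ∑ c_t S_t - a` is a constant multiple of `b`, which is a linear relation. -/
theorem eq_zero_of_sum_eq_fracD [ConnectedSpace V] (hp : IsLocalHomeomorph p)
    {𝒞 : Subalgebra ℂ (Holo p)} {ω : Letter n → Fin n → Holo p}
    {S : NCSeries (Holo p) (Letter n)} (hS1 : S [] = 1) (hS : IsSolution hp ω S)
    (h : LinearIndependent 𝒞 (fun t : Option (Letter n) => S t.toList)) (c : Letter n → ℂ)
    (f : FractionRing (Holo p)) (hf : f ∈ fracOf 𝒞)
    (hcf : ∑ t, c t • toFracForm (ω t) = fracD hp f) (t : Letter n) : c t = 0 := by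
  have := Holo.isDomain hp
  obtain ⟨a, ha, b, hb, hb0, hfab⟩ := hf
  set φ := algebraMap (Holo p) (FractionRing (Holo p)) with hφ
  have hg : fracD hp (φ (∑ t, c t • S [t]) - f) = 0 := by
    have hsub (k : Fin n) (x : FractionRing (Holo p)) :
        fracDer (pd hp k) (x - f) = fracDer (pd hp k) x - fracDer (pd hp k) f := by
      rw [eq_sub_iff_add_eq, ← fracDer_add, sub_add_cancel]
    funext k
    change fracDer (pd hp k) _ = 0
    rw [hsub, sub_eq_zero, fracDer_algebraMap]
    have h1 := congrFun hcf k
    rw [fracForm_apply'] at h1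
    refine Eq.trans (congrArg _ ?_) h1
    rw [map_sum, Finset.sum_apply]
    refine Finset.sum_congr rfl fun t _ => ?_
    rw [Derivation.map_smul, hS.pd_cons, hS1, mul_one, Pi.smul_apply]
  obtain ⟨κ, hκ⟩ := exists_eq_algebraMap_of_fracD_eq_zero hp hg
  have hrel := sum_smul_mul_eq_add_smul hfab hκ
  have hmem (i : Option (Letter n)) : (i.elim (-(a + κ • b)) fun t => c t • b) ∈ 𝒞 := by
    cases i with
    | none => exact 𝒞.neg_mem (𝒞.add_mem ha (𝒞.smul_mem hb κ))
    | some t => exact 𝒞.smul_mem hb (c t)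
  have hzero := (linearIndependent_subalgebra_iff 𝒞 _).1 h Finset.univ _ hmem (by
    rw [Fintype.sum_option]
    simp only [Option.elim_none, Option.elim_some, Option.toList_none, Option.toList_some, hS1,
      mul_one, smul_mul_assoc, hrel, neg_add_cancel]) (some t) (Finset.mem_univ _)
  exact (smul_eq_zero.1 hzero).resolve_right hb0

theorem linearIndependent_of_forall_eq_zero [ConnectedSpace V] (hp : IsLocalHomeomorph p)
    {𝒞 : Subalgebra ℂ (Holo p)} (h𝒞 : ∀ i : Fin n, ∀ f ∈ 𝒞, pd hp i f ∈ 𝒞)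
    {ω : Letter n → Fin n → Holo p} (hω𝒞 : ∀ t k, ω t k ∈ 𝒞)
    {S : NCSeries (Holo p) (Letter n)} (hS1 : S [] = 1) (hS : IsSolution hp ω S)
    (hE : ∀ c : Letter n → ℂ, ∀ f ∈ fracOf 𝒞,
      ∑ t, c t • toFracForm (ω t) = fracD hp f → ∀ t, c t = 0) :
    LinearIndependent 𝒞 (fun w : List (Letter n) => S w) := by
  classical
  have := Holo.isDomain hp
  let φ := algebraMap (Holo p) (FractionRing (Holo p))
  have hφ : Function.Injective φ := IsFractionRing.injective _ _
  let D : Fin n → FractionRing (Holo p) →+ FractionRing (Holo p) := fun k =>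
    { toFun := fracDer (pd hp k)
      map_zero' := congrFun (fracD_zero hp) k
      map_add' := fracDer_add (pd hp k) }
  refine (linearIndependent_subalgebra_iff 𝒞 _).2 fun s g hgC hg v hv => ?_
  have key := eq_zero_of_sum_wordSum_mul_eq_zero (D := D) (K := fracSubfield 𝒞)
    (ω := fun t k => φ (ω t k)) (S := fun w => φ (S w))
    (fun k => fracDer_mul (pd hp k)) (fun k a ha => fracDer_mem_fracOf (h𝒞 k) ha)
    (fun a ha => exists_eq_algebraMap_of_fracD_eq_zero hp (funext ha))
    (fun t k => algebraMap_mem_fracOf (hω𝒞 t k)) (by rw [hS1, map_one])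
    (fun k x w => by
      change fracDer (pd hp k) (φ _) = _
      rw [fracDer_algebraMap, hS.pd_cons, map_mul])
    (fun c f hf h => hE c f hf (funext fun k => (fracForm_apply ω c k).trans (h k)))
    (s.sup List.length) (fun w => if w ∈ s then φ (g w) else 0)
    (fun w => by
      split_ifs
      · exact algebraMap_mem_fracOf (hgC w)
      · exact Subfield.zero_mem _)
    (fun w hw => if_neg fun h => absurd (Finset.le_sup (f := List.length) h) (not_le.2 hw))
    (by
      simp only [ite_mul, zero_mul]
      rw [sum_wordSum_ite s fun w => φ (g w) * φ (S w), ← map_zero φ, ← hg, map_sum]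
      exact Finset.sum_congr rfl fun w _ => (map_mul φ _ _).symm) v
  rw [if_pos hv, map_eq_zero_iff φ hφ] at key
  exact key

theorem forall_eq_zero_iff [ConnectedSpace V] (hp : IsLocalHomeomorph p)
    (𝒞 : Subalgebra ℂ (Holo p)) (ω : Letter n → Fin n → Holo p) :
    (∀ c : Letter n → ℂ, ∀ f ∈ fracOf 𝒞,
      ∑ t, c t • toFracForm (ω t) = fracD hp f → ∀ t, c t = 0) ↔
    LinearIndependent ℂ ω ∧ fracD hp '' fracOf 𝒞 ∩
      (Submodule.span ℂ (Set.range fun t => toFracForm (ω t)) :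
        Set (Fin n → FractionRing (Holo p))) = {0} := by
  have := Holo.isDomain hp
  have h0 : (0 : FractionRing (Holo p)) ∈ fracOf 𝒞 := (fracSubfield 𝒞).zero_mem
  constructor
  · intro h
    constructor
    · rw [Fintype.linearIndependent_iff]
      intro c hc
      refine h c 0 h0 ?_
      funext k
      rw [fracForm_apply', hc, fracD_zero]
      simp
    · refine Set.eq_singleton_iff_unique_mem.2 ⟨⟨⟨0, h0, fracD_zero hp⟩, Submodule.zero_mem _⟩, ?_⟩
      rintro _ ⟨⟨f, hf, rfl⟩, hspan⟩
      obtain ⟨c, hc⟩ := (Submodule.mem_span_range_iff_exists_fun ℂ).1 hspan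
      rw [← hc]
      exact Finset.sum_eq_zero fun t _ => by rw [h c f hf hc t, zero_smul]
  · rintro ⟨hli, hcap⟩ c f hf hcf
    have hmem : ∑ t, c t • toFracForm (ω t) ∈ fracD hp '' fracOf 𝒞 ∩
        (Submodule.span ℂ (Set.range fun t => toFracForm (ω t)) :
          Set (Fin n → FractionRing (Holo p))) :=
      ⟨⟨f, hf, hcf.symm⟩, Submodule.sum_mem _ fun t _ =>
        Submodule.smul_mem _ _ (Submodule.subset_span ⟨t, rfl⟩)⟩
    rw [hcap, Set.mem_singleton_iff] at hmem
    refine Fintype.linearIndependent_iff.1 hli c ?_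
    funext k
    apply IsFractionRing.injective (Holo p) (FractionRing (Holo p))
    rw [← fracForm_apply', hmem]
    simp

end Independence

end NCDiff

theorem mainTheorem6 (n : ℕ) (V : Type*) [TopologicalSpace V] [T2Space V]
    [SimplyConnectedSpace V] (p : V → Fin n → ℂ) (hp : IsLocalHomeomorph p)
    (𝒞 : Subalgebra ℂ (NCDiff.Holo p))
    (h𝒞 : ∀ i : Fin n, ∀ f ∈ 𝒞, NCDiff.pd hp i f ∈ 𝒞)
    (ξ : NCDiff.Letter n → NCDiff.Holo p)
    (ω : NCDiff.Letter n → Fin n → NCDiff.Holo p)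
    (hω : ∀ t, ω t = NCDiff.totalD hp (ξ t))
    (hω𝒞 : ∀ t k, ω t k ∈ 𝒞)
    (S : NCDiff.NCSeries (NCDiff.Holo p) (NCDiff.Letter n))
    (hSgl : S.IsGrouplike) (hS : NCDiff.IsSolution hp ω S) :
    (∀ H : NCDiff.NCSeries (NCDiff.Holo p) (NCDiff.Letter n),
      (H.IsGrouplike ∧ NCDiff.IsSolution hp ω H) ↔
        ∃ C : NCDiff.NCSeries ℂ (NCDiff.Letter n), C.IsLieSeries ∧
          S = H.conc (NCDiff.NCSeries.exp (C.ofConst (NCDiff.Holo p)))) ∧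
    List.TFAE [
      LinearIndependent 𝒞 (fun w : List (NCDiff.Letter n) => S w),
      AlgebraicIndependent 𝒞
        (fun l : {l : List (NCDiff.Letter n) // NCDiff.IsLyndon NCDiff.Letter.lt l} => S l.1),
      AlgebraicIndependent 𝒞 (fun t : NCDiff.Letter n => S [t]),
      LinearIndependent 𝒞 (fun t : Option (NCDiff.Letter n) => S t.toList),
      ∀ c : NCDiff.Letter n → ℂ, ∀ f ∈ NCDiff.fracOf 𝒞,
        ∑ t, c t • NCDiff.toFracForm (ω t) = NCDiff.fracD hp f → ∀ t, c t = 0,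
      LinearIndependent ℂ ω ∧
        NCDiff.fracD hp '' NCDiff.fracOf 𝒞 ∩
          (Submodule.span ℂ (Set.range fun t => NCDiff.toFracForm (ω t)) :
            Set (Fin n → FractionRing (NCDiff.Holo p))) = {0}] := by
  have hS1 : S [] = 1 := hSgl.1
  refine ⟨NCDiff.isGrouplike_isSolution_iff hSgl hS, ?_⟩
  tfae_have 1 → 2 := NCDiff.algebraicIndependent_of_linearIndependent hp 𝒞 hSgl
  tfae_have 2 → 3 := fun h => h.comp
    (fun t : NCDiff.Letter n => ⟨[t], NCDiff.isLyndon_singleton _ t⟩)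
    (fun a b hab => by simpa using hab)
  tfae_have 3 → 4 := by
    intro h
    have h' := NCDiff.linearIndependent_option_of_algebraicIndependent h
    have e : (fun t : Option (NCDiff.Letter n) => S t.toList) =
        fun t => t.elim 1 fun t => S [t] := by
      funext t
      cases t with
      | none => exact hS1
      | some t => rfl
    rw [e]
    exact h'
  tfae_have 4 → 5 := NCDiff.eq_zero_of_sum_eq_fracD hp hS1 hS
  tfae_have 5 → 1 := NCDiff.linearIndependent_of_forall_eq_zero hp h𝒞 hω𝒞 hS1 hS
  tfae_have 5 ↔ 6 := NCDiff.forall_eq_zero_iff hp 𝒞 ω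
  tfae_finish
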